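/- Let $\Delta$ and $\Gamma$ be finite simplicial graphs. For a finite simplicial graph $\Lambda$, let $\mathbb{G}(\Lambda)$ be the partially commutative group (right-angled Artin group) generated by the vertices of $\Lambda$, with one defining relation $xy = yx$ for each pair of adjacent vertices $x, y$. Call $\Lambda$ atomic if it is (non-empty and) connected, has no vertices of valence $1$, has no cycles of length less than $5$, and has no separating closed stars, i.e. for no vertex $v$ does deleting $v$ together with all its neighbours leave a disconnected graph (the empty graph is not counted as disconnected). Suppose that $\Delta$ and $\Gamma$ are atomic. Then $\mathbb{G}(\Delta)$ embeds into $\mathbb{G}(\Gamma)$ and $\mathbb{G}(\Gamma)$ embeds into $\mathbb{G}(\Delta)$ (that is, there are injective group homomorphisms in both directions) if and only if $\Delta$ and $\Gamma$ are isomorphic graphs. -/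

import Mathlib

/-- The partially commutative group (right-angled Artin group) `𝔾(Γ)`: generated by the vertices
of `Γ`, with one defining relation `[x, y] = 1` for each pair of adjacent vertices. -/
abbrev PCGroup {V : Type*} (Γ : SimpleGraph V) : Type _ :=
  PresentedGroup {r : FreeGroup V | ∃ x y : V, Γ.Adj x y ∧
    r = FreeGroup.of x * FreeGroup.of y * (FreeGroup.of x)⁻¹ * (FreeGroup.of y)⁻¹}

/-- The vertices of the closed star of `v`: the vertex `v` together with its neighbours. -/
def closedStar {V : Type*} (Γ : SimpleGraph V) (v : V) : Set V :=
  {w | w = v ∨ Γ.Adj v w}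

/-- Atomic graphs: connected, without vertices of valence one, without cycles of length less than
five, and without separating closed stars of vertices (a closed star is separating if the subgraph
induced on its complement is disconnected; an empty complement does not count as disconnected). -/
structure IsAtomicGraph {V : Type*} (Γ : SimpleGraph V) : Prop where
  connected : Γ.Connected
  valence_ne_one : ∀ v : V, (Γ.neighborSet v).ncard ≠ 1
  five_le_length_of_isCycle : ∀ (v : V) (c : Γ.Walk v v), c.IsCycle → 5 ≤ c.length
  not_separating_closedStar : ∀ v : V, (Γ.induce (closedStar Γ v)ᶜ).Preconnected

/-!
# Atomic partially commutative groups embedding into each other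

That isomorphic graphs have isomorphic groups is clear. The converse is proved on the extension
graph of `Γ`, whose vertices are the conjugates of the generators of `PCGroup Γ`
(`PCGroup.IsVertex`), distinct ones being adjacent when they commute. It is the union of the
translates of the standard copy of `Γ` (`PCGroup.InCopy`).

*From embeddings of groups to embeddings of graphs.* In an atomic graph `Δ` with more than one
vertex, every vertex has two neighbours no powers of which commute in `PCGroup Δ`. In the group of a
graph `Γ` without triangles and squares, an element commuting with two such elements is conjugate to
a power of a generator (`PCGroup.exists_conj_eq_gen_zpow`). Hence an injective homomorphism
`φ : PCGroup Δ →* PCGroup Γ` induces a map of extension graphs, sending `w` to the vertex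
`PCGroup.root (φ w)` of which `φ w` is a power. This map is injective, equivariant and functorial,
and it preserves and reflects adjacency.

*Walls.* The tool for groups is the family of half-spaces of the Cayley graph bounded by walls
(`PCGroup.halfSpace`); they are constructed from an action of the group, without normal forms. The
key fact is that only finitely many walls separate two elements, so infinitely many translates of a
path crossing one wall must include two that differ by an element stabilising it
(`PCGroup.exists_mul_inv_mem_link`). The walls also show that finitely many vertices of the
extension graph lie in a common copy of `Γ` unless the star of some vertex separates two of them
(`PCGroup.exists_inCopy_of_not_separated`).

*Rigidity.* Let `Γ` be atomic with more than one vertex. Every injective endomorphism of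
`PCGroup Γ` maps `Γ` onto a full copy (`PCGroup.rigid_univ`). Indeed, take a set `Q` of vertices of
maximal size which every injective endomorphism maps into a single copy. If `Q` is not everything,
then some endomorphism followed by the removal of the star of some `v` separates the image of an
element of `Q` from the image of another vertex; `v` is not itself an image, since `Γ` has no
separating stars. Choose such a cut with the part on the side of `Q` as small as possible. If a
further endomorphism moved `v` out of all copies containing the image of `Q`, a star separating them
would be a cut with a smaller part: the two separating sets share at most one vertex, because the
extension graph contains no squares, and `Γ` has no cut vertices. So the image of `Q` together with
`v` is a larger set of the same kind, a contradiction.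

*Conclusion.* Given embeddings in both directions, suppose that the image of `Γ` in the extension
graph of `Δ` is not contained in one copy of `Δ`. Then the star of some vertex separates it. Mapping
back to the extension graph of `Γ`, where `Γ` becomes a full copy, this yields a vertex adjacent to
two vertices of a copy, thus in the copy, whose star separates `Γ`. This is impossible, so `Γ` is an
induced subgraph of `Δ` (`PCGroup.nonempty_embedding`). By symmetry and finiteness `Γ ≅ Δ`.
-/

namespace PCGroup

variable {V : Type*} {Γ : SimpleGraph V}

/-! ### Generators, words and standard subgroups -/

variable (Γ) in
/-- The generator of `PCGroup Γ` given by a vertex. -/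
def gen (x : V) : PCGroup Γ := PresentedGroup.of x

theorem gen_commute {x y : V} (h : Γ.Adj x y) : Commute (gen Γ x) (gen Γ y) := by
  have h1 : gen Γ x * gen Γ y * (gen Γ x)⁻¹ * (gen Γ y)⁻¹ = 1 :=
    PresentedGroup.one_of_mem (rels := {r : FreeGroup V | ∃ x y : V, Γ.Adj x y ∧
      r = FreeGroup.of x * FreeGroup.of y * (FreeGroup.of x)⁻¹ * (FreeGroup.of y)⁻¹})
      ⟨x, y, h, rfl⟩
  have h2 := mul_inv_eq_one.1 h1
  exact mul_inv_eq_iff_eq_mul.1 h2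

/-- The universal property of a partially commutative group. -/
def lift {H : Type*} [Group H] (f : V → H) (hf : ∀ x y, Γ.Adj x y → Commute (f x) (f y)) :
    PCGroup Γ →* H :=
  PresentedGroup.toGroup (f := f) (by
    rintro r ⟨x, y, h, rfl⟩
    have := (hf x y h).eq
    simp only [map_mul, map_inv, FreeGroup.lift_apply_of]
    rw [this]; group)

@[simp]
theorem lift_gen {H : Type*} [Group H] (f : V → H)
    (hf : ∀ x y, Γ.Adj x y → Commute (f x) (f y)) (x : V) : lift f hf (gen Γ x) = f x :=
  PresentedGroup.toGroup.of _

variable (Γ) in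
/-- A letter `(x, b)` is the generator `x` for `b = true` and its inverse for `b = false`. -/
def letter (a : V × Bool) : PCGroup Γ := cond a.2 (gen Γ a.1) (gen Γ a.1)⁻¹

variable (Γ) in
/-- The group element represented by a word in the letters. -/
def wordProd (w : List (V × Bool)) : PCGroup Γ := (w.map (letter Γ)).prod

@[simp] theorem wordProd_nil : wordProd Γ [] = 1 := rfl

@[simp] theorem wordProd_cons (a : V × Bool) (w : List (V × Bool)) :
    wordProd Γ (a :: w) = letter Γ a * wordProd Γ w := by simp [wordProd]

@[simp] theorem wordProd_append (w w' : List (V × Bool)) :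
    wordProd Γ (w ++ w') = wordProd Γ w * wordProd Γ w' := by simp [wordProd]

@[simp] theorem letter_not_mul (x : V) (b : Bool) : letter Γ (x, !b) = (letter Γ (x, b))⁻¹ := by
  cases b <;> simp [letter]

theorem commute_letter {x : V} {g : PCGroup Γ} (h : Commute (gen Γ x) g) (b : Bool) :
    Commute (letter Γ (x, b)) g := by
  cases b
  · exact h.inv_left
  · exact h

theorem exists_wordProd (g : PCGroup Γ) : ∃ w, wordProd Γ w = g := by
  obtain ⟨f, rfl⟩ := PresentedGroup.mk_surjective _ g
  obtain ⟨L, rfl⟩ := Quot.exists_rep f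
  refine ⟨L, ?_⟩
  induction L with
  | nil => exact (map_one _).symm
  | cons a L ih =>
    rw [wordProd_cons, ih]
    have : (Quot.mk _ (a :: L) : FreeGroup V) = FreeGroup.mk [a] * FreeGroup.mk L := by
      rw [FreeGroup.mul_mk]; rfl
    rw [this, map_mul]
    congr 1
    obtain ⟨x, b⟩ := a
    cases b
    · rfl
    · rfl

/-- Induction along the letters of a word, read from the left. -/
theorem letter_induction {P : PCGroup Γ → Prop} (one : P 1)
    (mul : ∀ g a, P g → P (g * letter Γ a)) (g : PCGroup Γ) : P g := by
  obtain ⟨w, rfl⟩ := exists_wordProd g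
  suffices h : ∀ g, P g → P (g * wordProd Γ w) by simpa using h 1 one
  induction w with
  | nil => simp
  | cons a w ih =>
    intro g hg
    rw [wordProd_cons, ← mul_assoc]
    exact ih _ (mul g a hg)

variable (Γ) in
/-- The standard subgroup generated by a set of vertices. -/
def par (A : Set V) : Subgroup (PCGroup Γ) := Subgroup.closure (gen Γ '' A)

theorem gen_mem_par {A : Set V} {x : V} (h : x ∈ A) : gen Γ x ∈ par Γ A :=
  Subgroup.subset_closure ⟨x, h, rfl⟩

theorem letter_mem_par {A : Set V} {x : V} (h : x ∈ A) (b : Bool) : letter Γ (x, b) ∈ par Γ A := by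
  cases b
  · exact inv_mem (gen_mem_par h)
  · exact gen_mem_par h

theorem par_mono {A B : Set V} (h : A ⊆ B) : par Γ A ≤ par Γ B :=
  Subgroup.closure_mono (Set.image_mono h)

/-- Induction along the letters of an element of a standard subgroup. -/
theorem par_induction {A : Set V} {P : PCGroup Γ → Prop} (one : P 1)
    (mul : ∀ g x b, g ∈ par Γ A → x ∈ A → P g → P (g * letter Γ (x, b)))
    {g : PCGroup Γ} (hg : g ∈ par Γ A) : P g := by
  induction hg using Subgroup.closure_induction_right with
  | one => exact one
  | mul_right g hg y hy ih =>
    obtain ⟨x, hx, rfl⟩ := hy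
    exact mul g x true hg hx ih
  | mul_inv_cancel g hg y hy ih =>
    obtain ⟨x, hx, rfl⟩ := hy
    exact mul g x false hg hx ih

theorem commute_of_mem_par {A : Set V} {h g : PCGroup Γ} (hA : ∀ x ∈ A, Commute h (gen Γ x))
    (hg : g ∈ par Γ A) : Commute h g := by
  induction hg using Subgroup.closure_induction with
  | mem y hy => obtain ⟨x, hx, rfl⟩ := hy; exact hA x hx
  | one => exact Commute.one_right _
  | mul a b _ _ ha hb => exact ha.mul_right hb
  | inv a _ ha => exact ha.inv_right

theorem gen_commute_of_mem_link {x : V} {l : PCGroup Γ} (hl : l ∈ par Γ (Γ.neighborSet x)) :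
    Commute (gen Γ x) l :=
  commute_of_mem_par (fun _ hy => gen_commute hy) hl

theorem link_subset_star (x : V) : Γ.neighborSet x ⊆ closedStar Γ x := fun _ h => Or.inr h

theorem gen_commute_of_mem_star {x : V} {l : PCGroup Γ} (hl : l ∈ par Γ (closedStar Γ x)) :
    Commute (gen Γ x) l := by
  refine commute_of_mem_par ?_ hl
  rintro y (rfl | h)
  · exact Commute.refl _
  · exact gen_commute h

open Classical in
variable (Γ) in
/-- The retraction onto a standard subgroup which kills the other generators. -/
noncomputable def retr (A : Set V) : PCGroup Γ →* PCGroup Γ :=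
  lift (fun x => if x ∈ A then gen Γ x else 1) (by
    intro x y h
    split_ifs
    · exact gen_commute h
    all_goals simp)

theorem retr_gen_of_mem {A : Set V} {x : V} (h : x ∈ A) : retr Γ A (gen Γ x) = gen Γ x := by
  simp [retr, h]

theorem retr_gen_of_notMem {A : Set V} {x : V} (h : x ∉ A) : retr Γ A (gen Γ x) = 1 := by
  simp [retr, h]

theorem retr_eq_self {A : Set V} {g : PCGroup Γ} (h : g ∈ par Γ A) : retr Γ A g = g := by
  induction h using Subgroup.closure_induction with
  | mem y hy => obtain ⟨x, hx, rfl⟩ := hy; exact retr_gen_of_mem hx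
  | one => exact map_one _
  | mul a b _ _ ha hb => rw [map_mul, ha, hb]
  | inv a _ ha => rw [map_inv, ha]

theorem retr_mem_inter {A B : Set V} {g : PCGroup Γ} (h : g ∈ par Γ B) :
    retr Γ A g ∈ par Γ (A ∩ B) := by
  induction h using Subgroup.closure_induction with
  | mem y hy =>
    obtain ⟨x, hx, rfl⟩ := hy
    by_cases hA : x ∈ A
    · rw [retr_gen_of_mem hA]; exact gen_mem_par ⟨hA, hx⟩
    · rw [retr_gen_of_notMem hA]; exact one_mem _
  | one => rw [map_one]; exact one_mem _
  | mul a b _ _ ha hb => rw [map_mul]; exact mul_mem ha hb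
  | inv a _ ha => rw [map_inv]; exact inv_mem ha

theorem mem_par_univ (g : PCGroup Γ) : g ∈ par Γ Set.univ := by
  refine letter_induction (one_mem _) (fun g a hg => mul_mem hg ?_) g
  exact letter_mem_par (Set.mem_univ _) _

theorem retr_mem {A : Set V} (g : PCGroup Γ) : retr Γ A g ∈ par Γ A := by
  simpa using retr_mem_inter (A := A) (mem_par_univ g)

theorem mem_par_inter {A B : Set V} {g : PCGroup Γ} (hA : g ∈ par Γ A) (hB : g ∈ par Γ B) :
    g ∈ par Γ (A ∩ B) := by
  rw [← retr_eq_self hA]; exact retr_mem_inter hB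

open Classical in
variable (Γ) in
/-- The exponent sum of a generator. -/
noncomputable def expSum (x : V) : PCGroup Γ →* Multiplicative ℤ :=
  lift (fun y => if y = x then Multiplicative.ofAdd 1 else 1) (fun _ _ _ => Commute.all _ _)

@[simp] theorem expSum_self (x : V) : expSum Γ x (gen Γ x) = Multiplicative.ofAdd 1 := by
  simp [expSum]

theorem expSum_of_ne {x y : V} (h : y ≠ x) : expSum Γ x (gen Γ y) = 1 := by
  simp [expSum, h]

theorem expSum_eq_one_of_mem_par {A : Set V} {x : V} (hx : x ∉ A) {g : PCGroup Γ}
    (hg : g ∈ par Γ A) : expSum Γ x g = 1 := by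
  induction hg using Subgroup.closure_induction with
  | mem y hy =>
    obtain ⟨z, hz, rfl⟩ := hy
    exact expSum_of_ne (fun h => hx (h ▸ hz))
  | one => exact map_one _
  | mul a b _ _ ha hb => rw [map_mul, ha, hb, one_mul]
  | inv a _ ha => rw [map_inv, ha, inv_one]

theorem gen_zpow_mem_par {A : Set V} {x : V} {n : ℤ} (hn : n ≠ 0) (h : gen Γ x ^ n ∈ par Γ A) :
    x ∈ A := by
  by_contra hx
  have h1 := expSum_eq_one_of_mem_par hx h
  rw [map_zpow, expSum_self, ← ofAdd_zsmul] at h1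
  exact hn (by simpa using h1)

theorem gen_mem_par_iff {A : Set V} {x : V} : gen Γ x ∈ par Γ A ↔ x ∈ A :=
  ⟨fun h => gen_zpow_mem_par one_ne_zero (by simpa using h), gen_mem_par⟩

theorem gen_injective : Function.Injective (gen Γ) := by
  intro x y h
  have : gen Γ x ∈ par Γ {y} := h ▸ gen_mem_par rfl
  exact (gen_mem_par_iff (A := {y})).1 this

theorem gen_zpow_ne_one {x : V} {n : ℤ} (hn : n ≠ 0) : gen Γ x ^ n ≠ 1 := by
  intro h
  have : gen Γ x ^ n ∈ par Γ (∅ : Set V) := h ▸ one_mem _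
  exact gen_zpow_mem_par hn this

/-! ### Half-spaces -/

open Classical in
/-- The permutations `P y` of `PCGroup Γ × ℤ` below satisfy the defining relations; the second
coordinate counts signed crossings of the wall dual to the edge from `1` to `x`. -/
theorem exists_crossing_count (x : V) : ∃ c : PCGroup Γ → ℤ, c 1 = 0 ∧
    ∀ g y, c (g * gen Γ y) = c g + if y = x ∧ g ∈ par Γ (Γ.neighborSet x) then 1 else 0 := by
  let i : V → PCGroup Γ → ℤ := fun y g => if y = x ∧ g ∈ par Γ (Γ.neighborSet x) then 1 else 0
  let P : V → Equiv.Perm (PCGroup Γ × ℤ) := fun y =>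
    { toFun := fun p => (p.1 * (gen Γ y)⁻¹, p.2 - i y (p.1 * (gen Γ y)⁻¹))
      invFun := fun p => (p.1 * gen Γ y, p.2 + i y p.1)
      left_inv := fun p => by simp
      right_inv := fun p => by simp }
  have hi : ∀ y z, Γ.Adj y z → ∀ g, i z (g * (gen Γ y)⁻¹) = i z g := by
    intro y z hyz g
    by_cases hz : z = x
    · subst hz
      have : (gen Γ y)⁻¹ ∈ par Γ (Γ.neighborSet z) := inv_mem (gen_mem_par hyz.symm)
      simp only [i, Subgroup.mul_mem_cancel_right _ this]
    · simp [i, hz]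
  have hP : ∀ y z, Γ.Adj y z → Commute (P y) (P z) := by
    intro y z hyz
    ext p : 1
    have hc : (gen Γ z)⁻¹ * (gen Γ y)⁻¹ = (gen Γ y)⁻¹ * (gen Γ z)⁻¹ :=
      ((gen_commute hyz).inv_inv).eq.symm
    have e : p.1 * (gen Γ z)⁻¹ * (gen Γ y)⁻¹ = p.1 * (gen Γ y)⁻¹ * (gen Γ z)⁻¹ := by
      rw [mul_assoc, hc, mul_assoc]
    have e1 := hi y z hyz (p.1 * (gen Γ z)⁻¹)
    have e2 := hi z y hyz.symm (p.1 * (gen Γ y)⁻¹)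
    refine Prod.ext e ?_
    change p.2 - i z (p.1 * (gen Γ z)⁻¹) - i y (p.1 * (gen Γ z)⁻¹ * (gen Γ y)⁻¹)
      = p.2 - i y (p.1 * (gen Γ y)⁻¹) - i z (p.1 * (gen Γ y)⁻¹ * (gen Γ z)⁻¹)
    rw [← e1, ← e2, e]
    ring
  let θ : PCGroup Γ →* Equiv.Perm (PCGroup Γ × ℤ) := lift P hP
  have k1 : ∀ g y, θ (g * gen Γ y)⁻¹ (1, 0) = (P y)⁻¹ (θ g⁻¹ (1, 0)) := by
    intro g y
    have : θ (gen Γ y) = P y := lift_gen _ _ _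
    rw [mul_inv_rev, map_mul, map_inv, this]; rfl
  have k2 : ∀ g y, θ (g * (gen Γ y)⁻¹)⁻¹ (1, 0) = P y (θ g⁻¹ (1, 0)) := by
    intro g y
    have : θ (gen Γ y) = P y := lift_gen _ _ _
    rw [mul_inv_rev, inv_inv, map_mul, this]; rfl
  have h1 : ∀ g, (θ g⁻¹ (1, 0)).1 = g := by
    intro g
    refine letter_induction (P := fun g => (θ g⁻¹ (1, 0)).1 = g) (by rw [inv_one, map_one]; rfl)
      ?_ g
    rintro g ⟨y, b⟩ hg
    cases b
    · change (θ (g * (gen Γ y)⁻¹)⁻¹ (1, 0)).1 = g * (gen Γ y)⁻¹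
      rw [k2]
      exact congrArg (· * (gen Γ y)⁻¹) hg
    · change (θ (g * gen Γ y)⁻¹ (1, 0)).1 = g * gen Γ y
      rw [k1]
      exact congrArg (· * gen Γ y) hg
  refine ⟨fun g => (θ g⁻¹ (1, 0)).2, by simp only [inv_one, map_one]; rfl, fun g y => ?_⟩
  change (θ (g * gen Γ y)⁻¹ (1, 0)).2 = (θ g⁻¹ (1, 0)).2 + i y g
  rw [k1]
  change (θ g⁻¹ (1, 0)).2 + i y (θ g⁻¹ (1, 0)).1 = _
  rw [h1]

theorem exists_halfSpace (x : V) (b : Bool) : ∃ F : Set (PCGroup Γ), 1 ∉ F ∧ letter Γ (x, b) ∈ F ∧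
    (∀ g a, g ∉ F → g * letter Γ a ∈ F → a = (x, b) ∧ g ∈ par Γ (Γ.neighborSet x)) := by
  classical
  obtain ⟨c, c1, hc⟩ := exists_crossing_count (Γ := Γ) x
  have hcL : ∀ g ∈ par Γ (Γ.neighborSet x), c g = 0 := by
    intro g hg
    refine par_induction (P := fun g => c g = 0) c1 ?_ hg
    intro g y b hg hy ih
    have hyx : y ≠ x := fun h => Γ.loopless.irrefl x (h ▸ hy)
    cases b
    · have := hc (g * (gen Γ y)⁻¹) y
      simp [hyx] at this
      simp [letter, ← this, ih]
    · simp [letter, hc, hyx, ih]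
  have hinv : ∀ g y, c (g * (gen Γ y)⁻¹) =
      c g - if y = x ∧ g * (gen Γ y)⁻¹ ∈ par Γ (Γ.neighborSet x) then 1 else 0 := by
    intro g y
    have := hc (g * (gen Γ y)⁻¹) y
    rw [inv_mul_cancel_right] at this
    rw [this]; ring
  have c01 : ∀ g, c g = 0 ∨ c g = 1 := by
    refine letter_induction (Or.inl c1) ?_
    rintro g ⟨y, b⟩ ih
    cases b
    · simp only [letter, cond_false]
      by_cases h : y = x ∧ g * (gen Γ y)⁻¹ ∈ par Γ (Γ.neighborSet x)
      · exact Or.inl (hcL _ h.2)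
      · rw [hinv, if_neg h, sub_zero]; exact ih
    · simp only [letter, cond_true]
      rw [hc]
      split_ifs with h
      · rw [hcL _ h.2]; right; rfl
      · simpa using ih
  have cx : c (gen Γ x) = 1 := by simpa [c1] using hc 1 x
  cases b
  · refine ⟨{g | c (gen Γ x * g) = 0}, by simp [cx], by simp [letter, c1], ?_⟩
    rintro g ⟨y, b⟩ h1 h2
    simp only [Set.mem_ofPred_eq] at h1 h2
    have h1 := (c01 _).resolve_left h1
    rw [← mul_assoc] at h2
    cases b
    · simp only [letter, cond_false] at h2
      rw [hinv, h1] at h2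
      split_ifs at h2 with h
      · obtain ⟨rfl, h⟩ := h
        refine ⟨rfl, ?_⟩
        have := gen_commute_of_mem_link h
        have e : gen Γ y * g * (gen Γ y)⁻¹ = g := by
          have := this.eq
          rw [inv_mul_cancel_right] at this
          exact mul_left_cancel this
        rwa [e] at h
      · simp at h2
    · simp only [letter, cond_true] at h2
      rw [hc, h1] at h2
      split_ifs at h2 <;> simp at h2
  · refine ⟨{g | c g = 1}, by simp [c1], by simp [letter, cx], ?_⟩
    rintro g ⟨y, b⟩ h1 h2
    simp only [Set.mem_ofPred_eq] at h1 h2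
    have h1 := (c01 _).resolve_right h1
    cases b
    · simp only [letter, cond_false] at h2
      rw [hinv, h1] at h2
      split_ifs at h2 <;> simp at h2
    · simp only [letter, cond_true] at h2
      rw [hc, h1] at h2
      split_ifs at h2 with h
      · obtain ⟨rfl, h⟩ := h
        exact ⟨rfl, h⟩
      · simp at h2

variable (Γ) in
/-- The half-space of the Cayley graph of `PCGroup Γ` bounded by the wall dual to the edge from `1`
to the letter `(x, b)`, on the side of that letter. Vertices adjacent to this wall form the coset
`par Γ (Γ.neighborSet x)` on the side of `1`. -/
noncomputable def halfSpace (x : V) (b : Bool) : Set (PCGroup Γ) :=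
  (exists_halfSpace (Γ := Γ) x b).choose

theorem one_notMem_halfSpace (x : V) (b : Bool) : 1 ∉ halfSpace Γ x b :=
  (exists_halfSpace x b).choose_spec.1

theorem letter_mem_halfSpace (x : V) (b : Bool) : letter Γ (x, b) ∈ halfSpace Γ x b :=
  (exists_halfSpace x b).choose_spec.2.1

theorem halfSpace_enter {x : V} {b : Bool} {g : PCGroup Γ} {a : V × Bool}
    (h1 : g ∉ halfSpace Γ x b) (h2 : g * letter Γ a ∈ halfSpace Γ x b) :
    a = (x, b) ∧ g ∈ par Γ (Γ.neighborSet x) :=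
  (exists_halfSpace x b).choose_spec.2.2 g a h1 h2

theorem halfSpace_exit {x : V} {b : Bool} {g : PCGroup Γ} {a : V × Bool}
    (h1 : g ∈ halfSpace Γ x b) (h2 : g * letter Γ a ∉ halfSpace Γ x b) :
    a = (x, !b) ∧ g * letter Γ a ∈ par Γ (Γ.neighborSet x) := by
  obtain ⟨y, c⟩ := a
  have h3 : g * letter Γ (y, c) * letter Γ (y, !c) = g := by simp
  obtain ⟨h4, h5⟩ := halfSpace_enter h2 (h3.symm ▸ h1)
  simp only [Prod.mk.injEq] at h4
  refine ⟨?_, h5⟩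
  rw [h4.1, ← h4.2, Bool.not_not]

theorem mul_letter_mem_halfSpace_iff {x y : V} (h : y ≠ x) (b c : Bool) (g : PCGroup Γ) :
    g * letter Γ (y, c) ∈ halfSpace Γ x b ↔ g ∈ halfSpace Γ x b := by
  constructor
  · intro h1
    by_contra h2
    exact h (congrArg Prod.fst (halfSpace_enter h2 h1).1)
  · intro h1
    by_contra h2
    exact h (congrArg Prod.fst (halfSpace_exit h1 h2).1)

theorem mul_mem_halfSpace_iff {A : Set V} {x : V} (hx : x ∉ A) (b : Bool) (g : PCGroup Γ)
    {l : PCGroup Γ} (hl : l ∈ par Γ A) : g * l ∈ halfSpace Γ x b ↔ g ∈ halfSpace Γ x b := by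
  refine par_induction (P := fun l => g * l ∈ halfSpace Γ x b ↔ g ∈ halfSpace Γ x b) (by simp) ?_ hl
  intro l y c _ hy ih
  rw [← mul_assoc, mul_letter_mem_halfSpace_iff (ne_of_mem_of_not_mem hy hx), ih]

theorem notMem_halfSpace_of_mem_par {A : Set V} {x : V} (hx : x ∉ A) (b : Bool) {l : PCGroup Γ}
    (hl : l ∈ par Γ A) : l ∉ halfSpace Γ x b := by
  have := mul_mem_halfSpace_iff hx b 1 hl
  rw [one_mul] at this
  exact fun h => one_notMem_halfSpace x b (this.1 h)

theorem self_notMem_link (x : V) : x ∉ Γ.neighborSet x := Γ.loopless.irrefl x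

/-- A path entering a half-space contains an edge crossing its wall. -/
theorem exists_enter {x : V} {b : Bool} (w : List (V × Bool)) {g : PCGroup Γ}
    (h1 : g ∉ halfSpace Γ x b) (h2 : g * wordProd Γ w ∈ halfSpace Γ x b) :
    ∃ w₁ w₂, w = w₁ ++ (x, b) :: w₂ ∧ g * wordProd Γ w₁ ∈ par Γ (Γ.neighborSet x) := by
  induction w generalizing g with
  | nil => simp at h2; exact absurd h2 h1
  | cons a w ih =>
    by_cases h3 : g * letter Γ a ∈ halfSpace Γ x b
    · obtain ⟨rfl, h4⟩ := halfSpace_enter h1 h3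
      exact ⟨[], w, rfl, by simpa using h4⟩
    · rw [wordProd_cons, ← mul_assoc] at h2
      obtain ⟨w₁, w₂, rfl, h4⟩ := ih h3 h2
      exact ⟨a :: w₁, w₂, rfl, by simpa [mul_assoc] using h4⟩

/-- A path leaving a half-space contains an edge crossing its wall. -/
theorem exists_exit {x : V} {b : Bool} (w : List (V × Bool)) {g : PCGroup Γ}
    (h1 : g ∈ halfSpace Γ x b) (h2 : g * wordProd Γ w ∉ halfSpace Γ x b) :
    ∃ w₁ w₂, w = w₁ ++ (x, !b) :: w₂ ∧
      g * wordProd Γ w₁ * letter Γ (x, !b) ∈ par Γ (Γ.neighborSet x) := by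
  induction w generalizing g with
  | nil => simp at h2; exact absurd h1 h2
  | cons a w ih =>
    by_cases h3 : g * letter Γ a ∈ halfSpace Γ x b
    · rw [wordProd_cons, ← mul_assoc] at h2
      obtain ⟨w₁, w₂, rfl, h4⟩ := ih h3 h2
      exact ⟨a :: w₁, w₂, rfl, by simpa [mul_assoc] using h4⟩
    · obtain ⟨rfl, h4⟩ := halfSpace_exit h1 h3
      exact ⟨[], w, rfl, by simpa using h4⟩

theorem conj_letter_mem_link_iff {x : V} {b : Bool} {g : PCGroup Γ} :
    letter Γ (x, b) * g * letter Γ (x, !b) ∈ par Γ (Γ.neighborSet x) ↔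
      g ∈ par Γ (Γ.neighborSet x) := by
  rw [letter_not_mul]
  constructor
  · intro h
    have := (commute_letter (gen_commute_of_mem_link h) b).eq
    rw [inv_mul_cancel_right] at this
    rwa [mul_left_cancel this] at h
  · intro h
    rwa [(commute_letter (gen_commute_of_mem_link h) b).eq, mul_inv_cancel_right]

variable (Γ) in
/-- A word is geodesic if no shorter word represents the same element. -/
def IsGeodesic (w : List (V × Bool)) : Prop :=
  ∀ w', wordProd Γ w' = wordProd Γ w → w.length ≤ w'.length

/-- A geodesic does not cross back the wall crossed by its first edge. -/
theorem IsGeodesic.wordProd_mem {x : V} {b : Bool} {w : List (V × Bool)}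
    (h : IsGeodesic Γ ((x, b) :: w)) : wordProd Γ ((x, b) :: w) ∈ halfSpace Γ x b := by
  by_contra h1
  rw [wordProd_cons] at h1
  obtain ⟨w₁, w₂, rfl, h2⟩ := exists_exit w (letter_mem_halfSpace x b) h1
  rw [conj_letter_mem_link_iff] at h2
  have h3 := (commute_letter (gen_commute_of_mem_link h2) b).eq
  have := h (w₁ ++ w₂) (by
    simp only [wordProd_cons, wordProd_append, letter_not_mul]
    rw [← mul_assoc, h3]; group)
  simp at this

/-- If infinitely many translates of the path from `1` to `u` cross the same wall, then two of them
do so in the same edge of the path, and thus differ by an element stabilising the wall. -/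
theorem exists_mul_inv_mem_link {x : V} {b : Bool} {u : PCGroup Γ} {f : ℕ → PCGroup Γ}
    (h1 : ∀ n, f n ∉ halfSpace Γ x b) (h2 : ∀ n, f n * u ∈ halfSpace Γ x b) :
    ∃ n m, n < m ∧ f m * (f n)⁻¹ ∈ par Γ (Γ.neighborSet x) := by
  obtain ⟨w, rfl⟩ := exists_wordProd u
  choose w₁ w₂ hw hm using fun n => exists_enter w (h1 n) (h2 n)
  have hle : ∀ n, (w₁ n).length < w.length := fun n => by
    conv_rhs => rw [hw n]
    simp
  obtain ⟨n, m, hnm, he⟩ := Finite.exists_ne_map_eq_of_infinite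
    (fun n => (⟨(w₁ n).length, hle n⟩ : Fin w.length))
  have he : (w₁ n).length = (w₁ m).length := congrArg Fin.val he
  have he : w₁ n = w₁ m := (List.append_inj ((hw n).symm.trans (hw m)) he).1
  have key : ∀ n m, w₁ n = w₁ m → f m * (f n)⁻¹ ∈ par Γ (Γ.neighborSet x) := by
    intro n m he
    have := mul_mem (hm m) (inv_mem (hm n))
    rw [he] at this
    simpa [mul_assoc] using this
  rcases lt_or_gt_of_ne hnm with h | h
  · exact ⟨n, m, h, key n m he⟩
  · exact ⟨m, n, h, key m n he.symm⟩

/-! ### Axes -/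

/-- If the base edge and its translate by `u` cross their walls in the same direction, with `1` on
the near side of both walls and `u * letter` on the far side of both, then the half-spaces are
nested. -/
theorem halfSpace_nested {x : V} {b : Bool} {u : PCGroup Γ} (h1 : u⁻¹ ∉ halfSpace Γ x b)
    (h2 : u * letter Γ (x, b) ∈ halfSpace Γ x b) {g : PCGroup Γ} (hg : g ∈ halfSpace Γ x b) :
    u * g ∈ halfSpace Γ x b := by
  suffices h : ∀ p, u⁻¹ * p ∈ halfSpace Γ x b → p ∈ halfSpace Γ x b from
    h _ (by simpa using hg)
  refine letter_induction (P := fun p => u⁻¹ * p ∈ halfSpace Γ x b → p ∈ halfSpace Γ x b)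
    (fun h => absurd (by simpa using h) h1) ?_
  intro p a ih h3
  by_cases h4 : u⁻¹ * p ∈ halfSpace Γ x b
  · by_contra h5
    have h6 := (halfSpace_exit (ih h4) h5).2
    rw [mul_mem_halfSpace_iff (self_notMem_link x) b _ h6] at h3
    exact h1 h3
  · rw [← mul_assoc] at h3
    obtain ⟨rfl, h5⟩ := halfSpace_enter h4 h3
    have h6 := (commute_letter (gen_commute_of_mem_link h5) b).eq
    have h7 : p * letter Γ (x, b) = u * letter Γ (x, b) * (u⁻¹ * p) := by
      rw [mul_assoc u, h6]; group
    rw [h7, mul_mem_halfSpace_iff (self_notMem_link x) b _ h5]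
    exact h2

/-- Every nontrivial element has a conjugate which translates some half-space into itself: the
conjugate is cyclically reduced, and the half-space is given by the first letter of a geodesic. -/
theorem exists_conj_translating {u : PCGroup Γ} (hu : u ≠ 1) : ∃ g x b,
    g⁻¹ * u * g ∈ halfSpace Γ x b ∧
      ∀ p ∈ halfSpace Γ x b, g⁻¹ * u * g * p ∈ halfSpace Γ x b := by
  classical
  have hex : ∃ n, ∃ g w, w.length = n ∧ wordProd Γ w = g⁻¹ * u * g := by
    obtain ⟨w, hw⟩ := exists_wordProd u
    exact ⟨_, 1, w, rfl, by simpa using hw⟩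
  obtain ⟨g, w, hwl, hw⟩ := Nat.find_spec hex
  have hmin : ∀ g' w', wordProd Γ w' = g'⁻¹ * u * g' → w.length ≤ w'.length := by
    intro g' w' h
    rw [hwl]
    exact Nat.find_min' hex ⟨g', w', rfl, h⟩
  clear hwl
  match w, hw, hmin with
  | [], hw, _ =>
    exfalso
    apply hu
    have : g * (g⁻¹ * u * g) * g⁻¹ = 1 := by rw [← hw]; simp
    rw [← this]; group
  | (x, b) :: w, hw, hmin =>
    have hgeo : IsGeodesic Γ ((x, b) :: w) := fun w' h => hmin g w' (h.trans hw)
    have h1 := hgeo.wordProd_mem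
    rw [hw] at h1
    set v := g⁻¹ * u * g with hv
    have h2 : v * letter Γ (x, b) ∈ halfSpace Γ x b := by
      by_contra h
      have := (halfSpace_exit h1 h).1
      simp at this
    refine ⟨g, x, b, h1, fun p hp => halfSpace_nested ?_ h2 hp⟩
    intro h3
    have h4 : v⁻¹ * letter Γ (x, b) ∈ halfSpace Γ x b := by
      by_contra h
      have := (halfSpace_exit h3 h).1
      simp at this
    have h5 : v⁻¹ * letter Γ (x, b) * wordProd Γ w = 1 := by
      rw [mul_assoc, ← wordProd_cons, hw, inv_mul_cancel]
    obtain ⟨w₁, w₂, rfl, h6⟩ := exists_exit w h4 (by rw [h5]; exact one_notMem_halfSpace x b)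
    have h7 : v⁻¹ * letter Γ (x, b) * wordProd Γ w₁ * letter Γ (x, !b) * wordProd Γ w₂ = 1 := by
      rw [← h5]; simp [mul_assoc]
    have h8 : wordProd Γ w₂ ∈ par Γ (Γ.neighborSet x) := by
      rw [eq_inv_of_mul_eq_one_right h7]
      exact inv_mem h6
    have h9 := (commute_letter (gen_commute_of_mem_link h8) b).eq
    have := hmin (g * letter Γ (x, b)) (w₁ ++ w₂) (by
      have : (g * letter Γ (x, b))⁻¹ * u * (g * letter Γ (x, b))
          = (letter Γ (x, b))⁻¹ * v * letter Γ (x, b) := by rw [hv]; group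
      rw [this, ← hw]
      simp only [wordProd_cons, wordProd_append, letter_not_mul, mul_assoc]
      rw [← h9]; group)
    simp at this

theorem zpow_mem_halfSpace {x : V} {b : Bool} {u : PCGroup Γ} (hu : u ∈ halfSpace Γ x b)
    (hF : ∀ p ∈ halfSpace Γ x b, u * p ∈ halfSpace Γ x b) {n : ℤ} (hn : 0 < n) :
    u ^ n ∈ halfSpace Γ x b := by
  induction n using Int.induction_on with
  | zero => exact absurd hn (lt_irrefl _)
  | succ n ih =>
    rcases Nat.eq_zero_or_pos n with rfl | h
    · simpa using hu
    · rw [add_comm, zpow_add, zpow_one]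
      exact hF _ (ih (by exact_mod_cast h))
  | pred n ih => omega

theorem zpow_notMem_halfSpace {x : V} {b : Bool} {u : PCGroup Γ}
    (hF : ∀ p ∈ halfSpace Γ x b, u * p ∈ halfSpace Γ x b) {n : ℤ} (hn : n ≤ 0) :
    u ^ n ∉ halfSpace Γ x b := by
  have key : ∀ (m : ℕ) p, p ∈ halfSpace Γ x b → u ^ m * p ∈ halfSpace Γ x b := by
    intro m
    induction m with
    | zero => simp
    | succ m ih => intro p hp; rw [pow_succ, mul_assoc]; exact ih _ (hF _ hp)
  obtain ⟨m, rfl⟩ := Int.exists_eq_neg_ofNat hn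
  intro h
  have := key m _ h
  rw [← zpow_natCast, ← zpow_add, add_neg_cancel, zpow_zero] at this
  exact one_notMem_halfSpace x b this

/-- The ends of the orbit `n ↦ u ^ n * h` do not depend on the base point `h`. -/
theorem eventually_mem_halfSpace {x : V} {b : Bool} {u : PCGroup Γ} (hu : u ∈ halfSpace Γ x b)
    (hF : ∀ p ∈ halfSpace Γ x b, u * p ∈ halfSpace Γ x b) (h : PCGroup Γ) :
    ∃ N : ℤ, ∀ n : ℤ, (N ≤ n → u ^ n * h ∈ halfSpace Γ x b) ∧
      (n ≤ -N → u ^ n * h ∉ halfSpace Γ x b) := by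
  have huniq : ∀ z : PCGroup Γ, ∀ n m : ℤ, u ^ n * z ∈ par Γ (Γ.neighborSet x) →
      u ^ m * z ∈ par Γ (Γ.neighborSet x) → n = m := by
    have hlt : ∀ z : PCGroup Γ, ∀ n m : ℤ, u ^ n * z ∈ par Γ (Γ.neighborSet x) →
      u ^ m * z ∈ par Γ (Γ.neighborSet x) → ¬ n < m := by
      intro z n m h1 h2 hlt
      have h3 := mul_mem h2 (inv_mem h1)
      have h4 : u ^ m * z * (u ^ n * z)⁻¹ = u ^ (m - n) := by
        rw [zpow_sub]; group
      rw [h4] at h3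
      exact notMem_halfSpace_of_mem_par (self_notMem_link x) b h3
        (zpow_mem_halfSpace hu hF (by omega))
    intro z n m h1 h2
    exact le_antisymm (not_lt.1 (hlt z m n h2 h1)) (not_lt.1 (hlt z n m h1 h2))
  refine letter_induction (P := fun h => ∃ N : ℤ, ∀ n : ℤ, (N ≤ n → u ^ n * h ∈ halfSpace Γ x b) ∧
      (n ≤ -N → u ^ n * h ∉ halfSpace Γ x b)) ?_ ?_ h
  · refine ⟨1, fun n => ⟨fun hn => ?_, fun hn => ?_⟩⟩
    · rw [mul_one]; exact zpow_mem_halfSpace hu hF (by omega)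
    · rw [mul_one]; exact zpow_notMem_halfSpace hF (by omega)
  · rintro g a ⟨N, hN⟩
    -- the wall is crossed at a given place of a translated path for at most one exponent
    have hfin : ∀ z : PCGroup Γ, ∃ M : ℤ, ∀ n : ℤ, M < n ∨ n < -M →
        u ^ n * z ∉ par Γ (Γ.neighborSet x) := by
      intro z
      by_cases hh : ∃ m : ℤ, u ^ m * z ∈ par Γ (Γ.neighborSet x)
      · obtain ⟨m, hm⟩ := hh
        refine ⟨|m|, fun n hn h => ?_⟩
        have := huniq _ n m h hm
        subst this
        rcases hn with hn | hn
        · exact absurd (le_abs_self n) (not_le.2 hn)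
        · exact absurd (neg_abs_le n) (not_le.2 hn)
      · push Not at hh
        exact ⟨0, fun n _ => hh n⟩
    obtain ⟨M, hM⟩ := hfin (g * letter Γ a)
    obtain ⟨K, hK⟩ := hfin g
    refine ⟨max N (max (M + 1) (K + 1)), fun n => ⟨fun hn => ?_, fun hn => ?_⟩⟩
    · by_contra h2
      have h1 := (hN n).1 (by omega)
      rw [← mul_assoc] at h2
      have := (halfSpace_exit h1 h2).2
      exact hM n (Or.inl (by omega)) (by rwa [mul_assoc] at this)
    · intro h2
      have h1 := (hN n).2 (by omega)
      rw [← mul_assoc] at h2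
      have := (halfSpace_enter h1 h2).2
      exact hK n (Or.inr (by omega)) this

/-- An element commuting with `u` permutes the finitely many `u`-orbits of walls crossed by an axis
of `u`, so some power of it agrees with a power of `u` up to an element stabilising the wall. -/
theorem exists_pow_mul_zpow_mem_link {x : V} {b : Bool} {u : PCGroup Γ} (hu : u ∈ halfSpace Γ x b)
    (hF : ∀ p ∈ halfSpace Γ x b, u * p ∈ halfSpace Γ x b) {a : PCGroup Γ} (ha : Commute u a) :
    ∃ p : ℕ, 0 < p ∧ ∃ k : ℤ, a ^ p * u ^ k ∈ par Γ (Γ.neighborSet x) := by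
  have h1 : ∀ i : ℕ, ∃ n : ℤ, u ^ n * (a ^ i)⁻¹ ∉ halfSpace Γ x b ∧
      u ^ n * (a ^ i)⁻¹ * u ∈ halfSpace Γ x b := by
    intro i
    obtain ⟨N, hN⟩ := eventually_mem_halfSpace hu hF (a ^ i)⁻¹
    by_contra hcon
    push Not at hcon
    have hstep : ∀ n : ℤ, u ^ n * (a ^ i)⁻¹ ∉ halfSpace Γ x b →
        u ^ (n + 1) * (a ^ i)⁻¹ ∉ halfSpace Γ x b := by
      intro n hn
      have := hcon n hn
      rwa [mul_assoc, ← ((ha.pow_right i).inv_right).eq, ← mul_assoc, ← zpow_add_one] at this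
    have hall : ∀ k : ℕ, u ^ (-|N| + k) * (a ^ i)⁻¹ ∉ halfSpace Γ x b := by
      intro k
      induction k with
      | zero => exact (hN _).2 (by have := le_abs_self N; push_cast; omega)
      | succ k ih => rw [Nat.cast_succ, ← add_assoc]; exact hstep _ ih
    refine hall (2 * |N|.toNat) ((hN _).1 ?_)
    have := le_abs_self N
    have := abs_nonneg N
    push_cast
    omega
  choose n hn1 hn2 using h1
  obtain ⟨i, j, hij, h⟩ := exists_mul_inv_mem_link hn1 hn2
  have h := inv_mem h
  refine ⟨j - i, by omega, n i - n j, ?_⟩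
  have e : (u ^ n j * (a ^ j)⁻¹ * (u ^ n i * (a ^ i)⁻¹)⁻¹)⁻¹ = a ^ (j - i) * u ^ (n i - n j) := by
    have c1 : Commute (u ^ n i) ((a ^ i)⁻¹) := ((ha.pow_right i).inv_right).zpow_left _
    have c2 : Commute (u ^ (n i - n j)) (a ^ (j - i)) := (ha.pow_right _).zpow_left _
    have e1 : a ^ j = a ^ (j - i) * a ^ i := by rw [← pow_add]; congr 1; omega
    have e2 : (u ^ n j * (a ^ j)⁻¹ * (u ^ n i * (a ^ i)⁻¹)⁻¹)⁻¹ =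
      u ^ n i * (a ^ i)⁻¹ * a ^ j * (u ^ n j)⁻¹ := by group
    have c3 : Commute (u ^ n i) ((a ^ i)⁻¹ * a ^ j) :=
      c1.mul_right ((ha.pow_right j).zpow_left _)
    have e3 : (a ^ i)⁻¹ * a ^ j = a ^ (j - i) := by
      rw [inv_mul_eq_iff_eq_mul, ← pow_add]; congr 1; omega
    rw [e2, mul_assoc _ _ (a ^ j), c3.eq, e3, mul_assoc, ← zpow_sub]
  rwa [e] at h

/-! ### Centralisers -/

/-- If `u` lies outside a standard subgroup, then a wall separates this subgroup from `u`. Powers of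
an element of the subgroup commuting with `u` move the wall to walls with the same property, of
which there are finitely many. -/
theorem exists_conj_pow_mem_link {A : Set V} {u : PCGroup Γ} (hu : u ∉ par Γ A) :
    ∃ h ∈ par Γ A, ∃ z ∉ A, ∀ c ∈ par Γ A, Commute u c →
      ∃ p : ℕ, 0 < p ∧ (h⁻¹ * c * h) ^ p ∈ par Γ (Γ.neighborSet z) := by
  classical
  have hex : ∃ n, ∃ h ∈ par Γ A, ∃ w, w.length = n ∧ wordProd Γ w = h⁻¹ * u := by
    obtain ⟨w, hw⟩ := exists_wordProd u
    exact ⟨_, 1, one_mem _, w, rfl, by simpa using hw⟩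
  obtain ⟨h, hh, w, hwl, hw⟩ := Nat.find_spec hex
  have hmin : ∀ h' ∈ par Γ A, ∀ w', wordProd Γ w' = h'⁻¹ * u → w.length ≤ w'.length := by
    intro h' hh' w' e
    rw [hwl]
    exact Nat.find_min' hex ⟨h', hh', w', rfl, e⟩
  clear hwl
  match w, hw, hmin with
  | [], hw, _ =>
    exfalso
    apply hu
    rw [wordProd_nil, eq_comm, inv_mul_eq_one] at hw
    exact hw ▸ hh
  | (z, b) :: w, hw, hmin =>
    have hgeo : IsGeodesic Γ ((z, b) :: w) := fun w' e => hmin h hh w' (e.trans hw)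
    have h1 := hgeo.wordProd_mem
    have hz : z ∉ A := by
      intro hz
      have := hmin (h * letter Γ (z, b)) (mul_mem hh (letter_mem_par hz b)) w (by
        rw [mul_inv_rev, mul_assoc, ← hw, wordProd_cons, inv_mul_cancel_left])
      simp at this
    refine ⟨h, hh, z, hz, fun c hc huc => ?_⟩
    have hc' : h⁻¹ * c * h ∈ par Γ A := mul_mem (mul_mem (inv_mem hh) hc) hh
    have hconj : ∀ n : ℕ, (h⁻¹ * c * h) ^ n = h⁻¹ * c ^ n * h := fun n => by
      simpa using (conj_pow (i := n) (a := h⁻¹) (b := c))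
    obtain ⟨n, m, hnm, h2⟩ := exists_mul_inv_mem_link (x := z) (b := b)
      (u := wordProd Γ ((z, b) :: w)) (f := fun n => (h⁻¹ * c * h) ^ n)
      (fun n => notMem_halfSpace_of_mem_par hz b (pow_mem hc' n)) (by
        intro n
        have e : (h⁻¹ * c * h) ^ n * wordProd Γ ((z, b) :: w) =
            wordProd Γ ((z, b) :: w) * c ^ n := by
          rw [hconj, hw, mul_assoc, mul_inv_cancel_left, mul_assoc, mul_assoc,
            (huc.pow_right n).eq]
        simp only [e]
        rw [mul_mem_halfSpace_iff hz b _ (pow_mem hc n)]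
        exact h1)
    refine ⟨m - n, by omega, ?_⟩
    rw [pow_sub _ hnm.le]
    exact h2

theorem self_mem_star (x : V) : x ∈ closedStar Γ x := Or.inl rfl

/-- The centraliser of a nontrivial power of a generator is the standard subgroup of its star. -/
theorem mem_star_of_commute_zpow {x : V} {n : ℤ} (hn : n ≠ 0) {g : PCGroup Γ}
    (h : Commute (gen Γ x ^ n) g) : g ∈ par Γ (closedStar Γ x) := by
  by_contra hg
  obtain ⟨k, hk, z, hz, H⟩ := exists_conj_pow_mem_link hg
  obtain ⟨p, hp, h1⟩ := H (gen Γ x ^ n) (zpow_mem (gen_mem_par (self_mem_star x)) n) h.symm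
  have e : k⁻¹ * gen Γ x ^ n * k = gen Γ x ^ n := by
    rw [mul_assoc, ((gen_commute_of_mem_star hk).zpow_left n).eq, inv_mul_cancel_left]
  rw [e, ← zpow_natCast, ← zpow_mul] at h1
  have := gen_zpow_mem_par (mul_ne_zero hn (by exact_mod_cast hp.ne')) h1
  exact hz (Or.inr (SimpleGraph.Adj.symm this))

theorem commute_gen_zpow_iff {x : V} {n : ℤ} (hn : n ≠ 0) {g : PCGroup Γ} :
    Commute (gen Γ x ^ n) g ↔ Commute (gen Γ x) g :=
  ⟨fun h => gen_commute_of_mem_star (mem_star_of_commute_zpow hn h), fun h => h.zpow_left n⟩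

theorem commute_gen_iff {x : V} {g : PCGroup Γ} :
    Commute (gen Γ x) g ↔ g ∈ par Γ (closedStar Γ x) :=
  ⟨fun h => mem_star_of_commute_zpow one_ne_zero (by simpa using h), gen_commute_of_mem_star⟩

theorem commute_gen_gen_iff {x y : V} : Commute (gen Γ x) (gen Γ y) ↔ y = x ∨ Γ.Adj x y := by
  rw [commute_gen_iff, gen_mem_par_iff]; rfl

theorem commute_of_mem_par_subsingleton {A : Set V} (hA : A.Subsingleton) {g h : PCGroup Γ}
    (hg : g ∈ par Γ A) (hh : h ∈ par Γ A) : Commute g h := by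
  refine commute_of_mem_par (fun x hx => (commute_of_mem_par (fun y hy => ?_) hg).symm) hh
  rw [hA hx hy]

theorem commute_conj_iff {G : Type*} [Group G] (g a b : G) :
    Commute (g * a * g⁻¹) (g * b * g⁻¹) ↔ Commute a b := by
  rw [Commute.conj_iff]

theorem conj_mem_link {x : V} {k l : PCGroup Γ} (hk : k ∈ par Γ (closedStar Γ x))
    (hl : l ∈ par Γ (Γ.neighborSet x)) : k⁻¹ * l * k ∈ par Γ (Γ.neighborSet x) := by
  have hk' := inv_mem hk
  have key : ∀ k ∈ par Γ (closedStar Γ x), ∀ l ∈ par Γ (Γ.neighborSet x),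
      k * l * k⁻¹ ∈ par Γ (Γ.neighborSet x) := by
    intro k hk
    induction hk using Subgroup.closure_induction'' with
    | mem y hy =>
      obtain ⟨z, rfl | hz, rfl⟩ := hy
      · intro l hl
        rwa [(gen_commute_of_mem_link hl).eq, mul_inv_cancel_right]
      · intro l hl
        have hz : gen Γ z ∈ par Γ (Γ.neighborSet x) := gen_mem_par hz
        exact mul_mem (mul_mem hz hl) (inv_mem hz)
    | inv_mem y hy =>
      obtain ⟨z, rfl | hz, rfl⟩ := hy
      · intro l hl
        rwa [((gen_commute_of_mem_link hl).inv_left).eq, mul_inv_cancel_right]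
      · intro l hl
        have hz : (gen Γ z)⁻¹ ∈ par Γ (Γ.neighborSet x) := inv_mem (gen_mem_par hz)
        exact mul_mem (mul_mem hz hl) (inv_mem hz)
    | one => intro l hl; simpa using hl
    | mul a b _ _ ha hb =>
      intro l hl
      have := ha _ (hb l hl)
      simpa [mul_assoc] using this
  simpa using key _ hk' l hl

/-- Elements no powers of which commute. -/
def PowersNotCommute {G : Type*} [Group G] (a b : G) : Prop :=
  ∀ p q : ℕ, 0 < p → 0 < q → ¬ Commute (a ^ p) (b ^ q)

variable (Γ) in
/-- Two distinct vertices have at most one common neighbour. -/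
def NoSquare : Prop :=
  ∀ ⦃x z a b : V⦄, x ≠ z → Γ.Adj x a → Γ.Adj z a → Γ.Adj x b → Γ.Adj z b → a = b

/-- In the absence of squares the common centraliser of two independent elements of the link of
`x` is contained in the star of `x`. -/
theorem mem_star_of_commute (hsq : NoSquare Γ) {x : V} {c₁ c₂ u : PCGroup Γ}
    (h1 : c₁ ∈ par Γ (Γ.neighborSet x)) (h2 : c₂ ∈ par Γ (Γ.neighborSet x))
    (h12 : PowersNotCommute c₁ c₂) (u1 : Commute u c₁) (u2 : Commute u c₂) :
    u ∈ par Γ (closedStar Γ x) := by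
  by_contra hu
  obtain ⟨h, hh, z, hz, H⟩ := exists_conj_pow_mem_link hu
  obtain ⟨p, hp, hp'⟩ := H c₁ (par_mono (link_subset_star x) h1) u1
  obtain ⟨q, hq, hq'⟩ := H c₂ (par_mono (link_subset_star x) h2) u2
  have hp'' := mem_par_inter (pow_mem (conj_mem_link hh h1) p) hp'
  have hq'' := mem_par_inter (pow_mem (conj_mem_link hh h2) q) hq'
  have hxz : x ≠ z := fun e => hz (Or.inl e.symm)
  have hs : (Γ.neighborSet x ∩ Γ.neighborSet z).Subsingleton :=
    fun a ha b hb => hsq hxz ha.1 ha.2 hb.1 hb.2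
  have hc := commute_of_mem_par_subsingleton hs hp'' hq''
  refine h12 p q hp hq ?_
  rw [← commute_conj_iff h⁻¹]
  have e : ∀ (c : PCGroup Γ) (n : ℕ), (h⁻¹ * c * h) ^ n = h⁻¹ * c ^ n * h⁻¹⁻¹ := fun c n => by
    simpa using (conj_pow (i := n) (a := h⁻¹) (b := c))
  rwa [e, e] at hc

variable (Γ) in
/-- No three vertices are pairwise adjacent. -/
def NoTriangle : Prop := ∀ ⦃x y z : V⦄, Γ.Adj x y → Γ.Adj x z → ¬ Γ.Adj y z

open Classical in
/-- In the absence of triangles the group of a link is free, and retracting onto it factors through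
the group of the graph without edges. -/
theorem exists_free_factor (ht : NoTriangle Γ) (x : V) :
    ∃ (ρ : PCGroup Γ →* PCGroup (⊥ : SimpleGraph V))
      (ι : PCGroup (⊥ : SimpleGraph V) →* PCGroup Γ),
      ∀ l ∈ par Γ (Γ.neighborSet x), ι (ρ l) = l := by
  refine ⟨lift (fun y => if y ∈ Γ.neighborSet x then gen ⊥ y else 1) ?_,
    lift (fun y => gen Γ y) (fun _ _ h => h.elim), ?_⟩
  · intro y z hyz
    by_cases hy : y ∈ Γ.neighborSet x
    · have : z ∉ Γ.neighborSet x := fun hz => ht hy hz hyz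
      simp [this]
    · simp [hy]
  · intro l hl
    induction hl using Subgroup.closure_induction with
    | mem y hy =>
      obtain ⟨z, hz, rfl⟩ := hy
      have hz : Γ.Adj x z := hz
      simp [hz]
    | one => simp
    | mul a b _ _ ha hb => rw [map_mul, map_mul, ha, hb]
    | inv a _ ha => rw [map_inv, map_inv, ha]

/-- In a free group only the identity commutes with two independent elements. -/
theorem eq_one_of_commute_bot {l c₁ c₂ : PCGroup (⊥ : SimpleGraph V)}
    (h12 : PowersNotCommute c₁ c₂) (u1 : Commute l c₁) (u2 : Commute l c₂) : l = 1 := by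
  by_contra hl
  obtain ⟨g, x, b, h1, h2⟩ := exists_conj_translating hl
  have hbot : ∀ y ∈ par (⊥ : SimpleGraph V) ((⊥ : SimpleGraph V).neighborSet x), y = 1 := by
    intro y hy
    refine par_induction (P := fun y => y = 1) rfl (fun _ _ _ _ h _ => ?_) hy
    exact h.elim
  have key : ∀ c, Commute l c → ∃ p : ℕ, 0 < p ∧ ∃ k : ℤ, c ^ p = l ^ k := by
    intro c hc
    have hc' : Commute (g⁻¹ * l * g) (g⁻¹ * c * g) := by
      simpa using (commute_conj_iff g⁻¹ l c).2 hc
    obtain ⟨p, hp, k, h⟩ := exists_pow_mul_zpow_mem_link h1 h2 hc'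
    have h := hbot _ h
    refine ⟨p, hp, -k, ?_⟩
    have e1 : (g⁻¹ * c * g) ^ p = g⁻¹ * c ^ p * g := by
      simpa using (conj_pow (i := p) (a := g⁻¹) (b := c))
    have e2 : (g⁻¹ * l * g) ^ k = g⁻¹ * l ^ k * g := by
      simpa using (conj_zpow (i := k) (a := g⁻¹) (b := l))
    rw [e1, e2] at h
    have h' : c ^ p * l ^ k = 1 := by
      have : c ^ p * l ^ k = g * (g⁻¹ * c ^ p * g * (g⁻¹ * l ^ k * g)) * g⁻¹ := by group
      rw [this, h]; group
    rw [zpow_neg]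
    exact eq_inv_of_mul_eq_one_left h'
  obtain ⟨p, hp, k, e1⟩ := key c₁ u1
  obtain ⟨q, hq, m, e2⟩ := key c₂ u2
  refine h12 p q hp hq ?_
  rw [e1, e2]
  exact (Commute.refl l).zpow_zpow k m

theorem eq_one_of_commute_link (ht : NoTriangle Γ) {x : V} {l c₁ c₂ : PCGroup Γ}
    (hl : l ∈ par Γ (Γ.neighborSet x)) (h1 : c₁ ∈ par Γ (Γ.neighborSet x))
    (h2 : c₂ ∈ par Γ (Γ.neighborSet x)) (h12 : PowersNotCommute c₁ c₂) (u1 : Commute l c₁)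
    (u2 : Commute l c₂) : l = 1 := by
  obtain ⟨ρ, ι, h⟩ := exists_free_factor ht x
  rw [← h l hl, eq_one_of_commute_bot (c₁ := ρ c₁) (c₂ := ρ c₂) ?_ (u1.map ρ) (u2.map ρ), map_one]
  intro p q hp hq hc
  refine h12 p q hp hq ?_
  have := hc.map ι
  rwa [map_pow, map_pow, h _ h1, h _ h2] at this

theorem exists_eq_zpow_mul_of_mem_star {x : V} {u : PCGroup Γ} (hu : u ∈ par Γ (closedStar Γ x)) :
    ∃ n : ℤ, ∃ l ∈ par Γ (Γ.neighborSet x), u = gen Γ x ^ n * l := by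
  induction hu using Subgroup.closure_induction with
  | mem y hy =>
    obtain ⟨z, rfl | hz, rfl⟩ := hy
    · exact ⟨1, 1, one_mem _, by simp⟩
    · exact ⟨0, _, gen_mem_par hz, by simp⟩
  | one => exact ⟨0, 1, one_mem _, by simp⟩
  | mul a b _ _ ha hb =>
    obtain ⟨n, l, hl, rfl⟩ := ha
    obtain ⟨m, k, hk, rfl⟩ := hb
    refine ⟨n + m, l * k, mul_mem hl hk, ?_⟩
    rw [zpow_add, mul_assoc, ← mul_assoc l, ← ((gen_commute_of_mem_link hl).zpow_left m).eq]
    group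
  | inv a _ ha =>
    obtain ⟨n, l, hl, rfl⟩ := ha
    refine ⟨-n, l⁻¹, inv_mem hl, ?_⟩
    rw [mul_inv_rev, zpow_neg]
    exact (((gen_commute_of_mem_link hl).zpow_left n).inv_inv).eq.symm

/-- An element `u` whose centraliser contains elements independent modulo powers of `u` is
conjugate to a power of a generator. -/
theorem exists_conj_eq_gen_zpow (ht : NoTriangle Γ) (hsq : NoSquare Γ) {u a b : PCGroup Γ}
    (hu : u ≠ 1) (ha : Commute u a) (hb : Commute u b) (hab : PowersNotCommute a b) :
    ∃ g x, ∃ n : ℤ, n ≠ 0 ∧ u = g * gen Γ x ^ n * g⁻¹ := by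
  obtain ⟨g, x, s, h1, h2⟩ := exists_conj_translating hu
  set v := g⁻¹ * u * g with hv
  have hcv : ∀ c, Commute u c → Commute v (g⁻¹ * c * g) := fun c hc => by
    simpa using (commute_conj_iff g⁻¹ u c).2 hc
  have ha' := hcv a ha
  have hb' := hcv b hb
  obtain ⟨p, hp, k, hk⟩ := exists_pow_mul_zpow_mem_link h1 h2 ha'
  obtain ⟨q, hq, m, hm⟩ := exists_pow_mul_zpow_mem_link h1 h2 hb'
  have hpn : PowersNotCommute ((g⁻¹ * a * g) ^ p * v ^ k) ((g⁻¹ * b * g) ^ q * v ^ m) := by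
    intro r t hr ht' hc
    refine hab (p * r) (q * t) (Nat.mul_pos hp hr) (Nat.mul_pos hq ht') ?_
    have c1 : Commute ((g⁻¹ * a * g) ^ p) (v ^ k) := (ha'.symm.pow_left p).zpow_right k
    have c2 : Commute ((g⁻¹ * b * g) ^ q) (v ^ m) := (hb'.symm.pow_left q).zpow_right m
    rw [c1.mul_pow, c2.mul_pow, ← pow_mul, ← pow_mul] at hc
    -- the factors which are powers of `v` are central in everything in sight
    have z1 : ∀ (n : ℤ) (j : ℕ) (i : ℕ), Commute ((v ^ n) ^ j) ((g⁻¹ * b * g) ^ i) := fun n j i =>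
      ((hb'.zpow_left n).pow_left j).pow_right i
    have z2 : ∀ (n : ℤ) (j : ℕ) (i : ℕ), Commute ((v ^ n) ^ j) ((g⁻¹ * a * g) ^ i) := fun n j i =>
      ((ha'.zpow_left n).pow_left j).pow_right i
    have z3 : ∀ (n n' : ℤ) (j j' : ℕ), Commute ((v ^ n) ^ j) ((v ^ n') ^ j') := fun n n' j j' =>
      (((Commute.refl v).zpow_zpow n n').pow_left j).pow_right j'
    have d1 : Commute ((g⁻¹ * a * g) ^ (p * r) * (v ^ k) ^ r) ((v ^ m) ^ t) :=
      (z2 _ _ _).symm.mul_left (z3 _ _ _ _)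
    have d2 : Commute ((g⁻¹ * a * g) ^ (p * r) * (v ^ k) ^ r) ((g⁻¹ * b * g) ^ (q * t)) := by
      have := hc.mul_right d1.inv_right
      rwa [mul_inv_cancel_right] at this
    have d3 : Commute ((g⁻¹ * a * g) ^ (p * r)) ((g⁻¹ * b * g) ^ (q * t)) := by
      have := d2.mul_left (z1 k r (q * t)).inv_left
      rwa [mul_inv_cancel_right] at this
    rw [← commute_conj_iff g⁻¹]
    have e : ∀ (c : PCGroup Γ) (n : ℕ), (g⁻¹ * c * g) ^ n = g⁻¹ * c ^ n * g⁻¹⁻¹ := fun c n => by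
      simpa using (conj_pow (i := n) (a := g⁻¹) (b := c))
    rwa [e, e] at d3
  have e1 : Commute v ((g⁻¹ * a * g) ^ p * v ^ k) :=
    (ha'.pow_right p).mul_right ((Commute.refl v).zpow_right k)
  have e2 : Commute v ((g⁻¹ * b * g) ^ q * v ^ m) :=
    (hb'.pow_right q).mul_right ((Commute.refl v).zpow_right m)
  obtain ⟨n, l, hl, hvl⟩ := exists_eq_zpow_mul_of_mem_star (mem_star_of_commute hsq hk hm hpn e1 e2)
  have hl1 : l = 1 := by
    have el : l = (gen Γ x ^ n)⁻¹ * v := by rw [hvl]; group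
    refine eq_one_of_commute_link ht hl hk hm hpn ?_ ?_
    · rw [el]; exact (((gen_commute_of_mem_link hk).zpow_left n).inv_left).mul_left e1
    · rw [el]; exact (((gen_commute_of_mem_link hm).zpow_left n).inv_left).mul_left e2
  rw [hl1, mul_one] at hvl
  have hu' : u = g * gen Γ x ^ n * g⁻¹ := by rw [← hvl, hv]; group
  refine ⟨g, x, n, ?_, hu'⟩
  rintro rfl
  apply hu
  rw [hu']; group

/-! ### The extension graph -/

/-- The vertices of the extension graph: the conjugates of the generators. Distinct vertices are
adjacent when they commute. -/
def IsVertex (w : PCGroup Γ) : Prop := ∃ g x, w = g * gen Γ x * g⁻¹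

/-- The vertex `w` of the extension graph lies in the translate by `g` of the standard copy
of `Γ`. -/
def InCopy (g w : PCGroup Γ) : Prop := ∃ x, w = g * gen Γ x * g⁻¹

theorem InCopy.isVertex {g w : PCGroup Γ} (h : InCopy g w) : IsVertex w := ⟨g, h⟩

theorem isVertex_gen (x : V) : IsVertex (gen Γ x) := ⟨1, x, by simp⟩

theorem InCopy.conj {g w : PCGroup Γ} (h : InCopy g w) (k : PCGroup Γ) :
    InCopy (k * g) (k * w * k⁻¹) := by
  obtain ⟨x, rfl⟩ := h
  exact ⟨x, by group⟩

theorem IsVertex.conj {w : PCGroup Γ} (h : IsVertex w) (k : PCGroup Γ) :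
    IsVertex (k * w * k⁻¹) := by
  obtain ⟨g, h⟩ := h
  exact (InCopy.conj h k).isVertex

theorem IsVertex.ne_one {w : PCGroup Γ} (h : IsVertex w) : w ≠ 1 := by
  obtain ⟨g, x, rfl⟩ := h
  intro h
  have h' : gen Γ x ^ (1 : ℤ) = 1 := by
    rw [zpow_one]
    have : gen Γ x = g⁻¹ * (g * gen Γ x * g⁻¹) * g := by group
    rw [this, h]; group
  exact gen_zpow_ne_one one_ne_zero h'

theorem IsVertex.commute_zpow_iff {w : PCGroup Γ} (h : IsVertex w) {n : ℤ} (hn : n ≠ 0)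
    {a : PCGroup Γ} : Commute (w ^ n) a ↔ Commute w a := by
  obtain ⟨g, x, rfl⟩ := h
  have e : a = g * (g⁻¹ * a * g) * g⁻¹ := by group
  rw [conj_zpow, e, commute_conj_iff, commute_conj_iff, commute_gen_zpow_iff hn]

theorem InCopy.eq_gen {g₁ g₂ : PCGroup Γ} {x y : V}
    (h : g₁ * gen Γ x * g₁⁻¹ = g₂ * gen Γ y * g₂⁻¹) : x = y := by
  by_contra hne
  have := congrArg (expSum Γ x) h
  simp only [map_mul, map_inv, mul_inv_cancel_comm, expSum_self,
    expSum_of_ne (Ne.symm hne)] at this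
  exact absurd this (by decide)

/-- Commuting vertices lie in a common copy. -/
theorem exists_inCopy_of_commute {w₁ w₂ : PCGroup Γ} (h1 : IsVertex w₁) (h2 : IsVertex w₂)
    (hc : Commute w₁ w₂) : ∃ g, InCopy g w₁ ∧ InCopy g w₂ := by
  obtain ⟨h, x, rfl⟩ := h1
  obtain ⟨k, y, e⟩ : IsVertex (h⁻¹ * w₂ * h) := by simpa using h2.conj h⁻¹
  have hc' : Commute (gen Γ x) (h⁻¹ * w₂ * h) := by
    have e : w₂ = h * (h⁻¹ * w₂ * h) * h⁻¹ := by group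
    rwa [e, commute_conj_iff] at hc
  have hm := retr_eq_self (commute_gen_iff.1 hc')
  rw [e, map_mul, map_mul, map_inv] at hm
  have hrm : Commute (gen Γ x) (retr Γ (closedStar Γ x) k) := commute_gen_iff.2 (retr_mem k)
  by_cases hy : y ∈ closedStar Γ x
  · rw [retr_gen_of_mem hy, ← e] at hm
    generalize retr Γ (closedStar Γ x) k = r at hm hrm
    refine ⟨h * r, ⟨x, ?_⟩, ⟨y, ?_⟩⟩
    · have e3 : h * r * gen Γ x * (h * r)⁻¹ = h * (r * gen Γ x * r⁻¹) * h⁻¹ := by group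
      rw [e3, ← hrm.eq, mul_inv_cancel_right]
    · have e3 : h * r * gen Γ y * (h * r)⁻¹ = h * (r * gen Γ y * r⁻¹) * h⁻¹ := by group
      rw [e3, hm]; group
  · rw [retr_gen_of_notMem hy, mul_one, mul_inv_cancel] at hm
    exact absurd hm.symm (IsVertex.ne_one ⟨k, y, rfl⟩)

theorem eq_of_zpow_eq_zpow {w₁ w₂ : PCGroup Γ} (h1 : IsVertex w₁) (h2 : IsVertex w₂) {n m : ℤ}
    (hn : n ≠ 0) (h : w₁ ^ n = w₂ ^ m) : w₁ = w₂ := by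
  have hc : Commute (w₁ ^ n) w₂ := by rw [h]; exact (Commute.refl w₂).zpow_left m
  rw [h1.commute_zpow_iff hn] at hc
  obtain ⟨g, ⟨x, rfl⟩, ⟨y, rfl⟩⟩ := exists_inCopy_of_commute h1 h2 hc
  rw [conj_zpow, conj_zpow] at h
  rw [mul_left_inj, mul_right_inj] at h
  have h4 : gen Γ x ^ n ∈ par Γ {y} := by
    rw [h]; exact zpow_mem (gen_mem_par (Set.mem_singleton y)) m
  have h5 : x = y := gen_zpow_mem_par (A := {y}) hn h4
  rw [h5]

/-! ### Separation in the extension graph -/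

/-- The vertex `p` lies in a copy on the far side of the wall obtained from the wall of
`halfSpace Γ x b` by translation by `k`. If `p` does not commute with `k * gen Γ x * k⁻¹`, then all
copies containing `p` lie on the same side. -/
def OnFarSide (k : PCGroup Γ) (x : V) (b : Bool) (p : PCGroup Γ) : Prop :=
  ∃ g, InCopy g p ∧ k⁻¹ * g ∈ halfSpace Γ x b

theorem onFarSide_iff {k : PCGroup Γ} {x : V} {b : Bool} {p g : PCGroup Γ}
    (hp : ¬ Commute (k * gen Γ x * k⁻¹) p) (hg : InCopy g p) :
    OnFarSide k x b p ↔ k⁻¹ * g ∈ halfSpace Γ x b := by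
  suffices H : ∀ g₁, InCopy g₁ p → (k⁻¹ * g₁ ∈ halfSpace Γ x b ↔ k⁻¹ * g ∈ halfSpace Γ x b) from
    ⟨fun ⟨g₁, h1, h2⟩ => (H g₁ h1).1 h2, fun h => ⟨g, hg, h⟩⟩
  intro g₁ hg₁
  obtain ⟨y, rfl⟩ := hg
  obtain ⟨y', e⟩ := hg₁
  obtain rfl := InCopy.eq_gen e
  have hs : g⁻¹ * g₁ ∈ par Γ (closedStar Γ y) := by
    rw [← commute_gen_iff]
    have e' : g * gen Γ y * g⁻¹ * g₁ = g₁ * gen Γ y := by rw [e]; group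
    have : gen Γ y * (g⁻¹ * g₁) = g⁻¹ * (g * gen Γ y * g⁻¹ * g₁) := by group
    change gen Γ y * (g⁻¹ * g₁) = g⁻¹ * g₁ * gen Γ y
    rw [this, e', mul_assoc]
  have e1 : g₁ = g * (g⁻¹ * g₁) := by group
  rw [e1, ← mul_assoc]
  -- a crossing of the wall inside the coset `g * par Γ (closedStar Γ y)` is impossible
  have key : ∀ s ∈ par Γ (closedStar Γ y), x ∈ closedStar Γ y →
      k⁻¹ * g * s ∉ par Γ (Γ.neighborSet x) := by
    intro s hs hx hl
    apply hp
    have e2 : k * gen Γ x * k⁻¹ = g * s * gen Γ x * (g * s)⁻¹ := by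
      have := (gen_commute_of_mem_link hl).eq
      have e3 : g * s = k * (k⁻¹ * g * s) := by group
      rw [e3, mul_assoc k (k⁻¹ * g * s), ← this]; group
    have e4 : g * gen Γ y * g⁻¹ = g * s * gen Γ y * (g * s)⁻¹ := by
      have := (gen_commute_of_mem_star hs).eq
      rw [mul_assoc g s, ← this]; group
    rw [e2, e4, commute_conj_iff]
    exact (gen_commute_of_mem_star (gen_mem_par hx)).symm
  refine par_induction (P := fun s => k⁻¹ * g * s ∈ halfSpace Γ x b ↔ k⁻¹ * g ∈ halfSpace Γ x b)
    (by simp) ?_ hs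
  intro s z c hs hz ih
  rw [← ih, ← mul_assoc]
  constructor
  · intro h1
    by_contra h2
    obtain ⟨h3, h4⟩ := halfSpace_enter h2 h1
    rw [(Prod.mk.inj h3).1] at hz
    exact key s hs hz h4
  · intro h1
    by_contra h2
    obtain ⟨h3, h4⟩ := halfSpace_exit h1 h2
    rw [(Prod.mk.inj h3).1] at hz
    rw [mul_assoc] at h4
    exact key _ (mul_mem hs (letter_mem_par ((Prod.mk.inj h3).1 ▸ hz) c)) hz h4

theorem onFarSide_congr {k : PCGroup Γ} {x : V} {b : Bool} {p q g : PCGroup Γ}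
    (hp : ¬ Commute (k * gen Γ x * k⁻¹) p) (hq : ¬ Commute (k * gen Γ x * k⁻¹) q)
    (hgp : InCopy g p) (hgq : InCopy g q) : OnFarSide k x b p ↔ OnFarSide k x b q := by
  rw [onFarSide_iff hp hgp, onFarSide_iff hq hgq]

/-- The vertices not commuting with a given one are partitioned into sides without edges
between them. -/
theorem onFarSide_congr_of_commute {k : PCGroup Γ} {x : V} {b : Bool} {p q : PCGroup Γ}
    (hp : ¬ Commute (k * gen Γ x * k⁻¹) p) (hq : ¬ Commute (k * gen Γ x * k⁻¹) q)
    (vp : IsVertex p) (vq : IsVertex q) (hc : Commute p q) :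
    OnFarSide k x b p ↔ OnFarSide k x b q := by
  obtain ⟨g, h1, h2⟩ := exists_inCopy_of_commute vp vq hc
  exact onFarSide_congr hp hq h1 h2

/-- The distance in the Cayley graph from `g` to the set of all `h` such that the copy of `Γ`
translated by `h` contains `p`. -/
noncomputable def copyDist (g p : PCGroup Γ) : ℕ :=
  sInf {n | ∃ w, w.length = n ∧ InCopy (g * wordProd Γ w) p}

theorem copyDist_le {g p : PCGroup Γ} {w : List (V × Bool)} (h : InCopy (g * wordProd Γ w) p) :
    copyDist g p ≤ w.length := Nat.sInf_le ⟨w, rfl, h⟩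

theorem exists_copyDist (g : PCGroup Γ) {p : PCGroup Γ} (hp : IsVertex p) :
    ∃ w, w.length = copyDist g p ∧ InCopy (g * wordProd Γ w) p := by
  refine Nat.sInf_mem (s := {n | ∃ w, w.length = n ∧ InCopy (g * wordProd Γ w) p}) ?_
  obtain ⟨h, hh⟩ := hp
  obtain ⟨w, hw⟩ := exists_wordProd (g⁻¹ * h)
  exact ⟨_, w, rfl, by rw [hw, mul_inv_cancel_left]; exact hh⟩

theorem copyDist_mul_left {g p h : PCGroup Γ} (hc : Commute h p) (hp : IsVertex p) :
    copyDist (h * g) p ≤ copyDist g p := by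
  obtain ⟨w, hw, hi⟩ := exists_copyDist g hp
  rw [← hw]
  apply copyDist_le
  have := hi.conj h
  rwa [hc.eq, mul_inv_cancel_right, ← mul_assoc] at this

/-- Vertices no two of which are separated by the star of a vertex lie in a common copy. Moving
from a copy towards one of the vertices not in it brings it closer to every vertex whose distance
changes. -/
theorem exists_inCopy_of_not_separated (E : Finset (PCGroup Γ)) (hE : ∀ p ∈ E, IsVertex p)
    (H : ∀ k x b, ∀ p ∈ E, ∀ q ∈ E, ¬ Commute (k * gen Γ x * k⁻¹) p →
      ¬ Commute (k * gen Γ x * k⁻¹) q → OnFarSide k x b p → OnFarSide k x b q) :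
    ∃ g, ∀ p ∈ E, InCopy g p := by
  let D : PCGroup Γ → ℕ := fun g => ∑ p ∈ E, copyDist g p
  let g := Function.argmin D
  have hg : ∀ g', D g ≤ D g' := fun g' => Function.argmin_le D g'
  refine ⟨g, ?_⟩
  by_contra hcon
  push Not at hcon
  obtain ⟨p, hpE, hp⟩ := hcon
  obtain ⟨w, hwl, hw⟩ := exists_copyDist g (hE p hpE)
  match w, hwl, hw with
  | [], _, hw => exact hp (by simpa using hw)
  | (x, b) :: w, hwl, hw =>
    have hstep : ∀ q, IsVertex q → Commute (g * gen Γ x * g⁻¹) q →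
        ∀ c, copyDist (g * letter Γ (x, c)) q ≤ copyDist g q := by
      intro q vq hc c
      have e : g * letter Γ (x, c) = (g * letter Γ (x, c) * g⁻¹) * g := by group
      rw [e]
      refine copyDist_mul_left ?_ vq
      have e2 : q = g * (g⁻¹ * q * g) * g⁻¹ := by group
      rw [e2, commute_conj_iff] at hc ⊢
      exact commute_letter hc c
    have hlt : copyDist (g * letter Γ (x, b)) p < copyDist g p := by
      rw [← hwl]
      have : InCopy (g * letter Γ (x, b) * wordProd Γ w) p := by
        rwa [wordProd_cons, ← mul_assoc] at hw
      exact lt_of_le_of_lt (copyDist_le this) (by simp)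
    have hgeo : IsGeodesic Γ ((x, b) :: w) := fun w' e => by
      rw [hwl]
      exact copyDist_le (by rw [e]; exact hw)
    have hpc : ¬ Commute (g * gen Γ x * g⁻¹) p := by
      intro hc
      have h3 : copyDist g p ≤ copyDist (g * letter Γ (x, b)) p := by
        have e3 : g = (g * (letter Γ (x, b))⁻¹ * g⁻¹) * (g * letter Γ (x, b)) := by group
        conv_lhs => rw [e3]
        refine copyDist_mul_left ?_ (hE p hpE)
        have e2 : p = g * (g⁻¹ * p * g) * g⁻¹ := by group
        rw [e2, commute_conj_iff] at hc ⊢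
        exact (commute_letter hc b).inv_left
      omega
    have hfar : OnFarSide g x b p :=
      ⟨_, hw, by rw [inv_mul_cancel_left]; exact hgeo.wordProd_mem⟩
    refine absurd (hg (g * letter Γ (x, b))) (not_le.2 ?_)
    refine Finset.sum_lt_sum (fun q hq => ?_) ⟨p, hpE, hlt⟩
    by_cases hqc : Commute (g * gen Γ x * g⁻¹) q
    · exact hstep q (hE q hq) hqc b
    · have hq' := H g x b p hpE q hq hpc hqc hfar
      obtain ⟨w', hwl', hw'⟩ := exists_copyDist g (hE q hq)
      rw [onFarSide_iff hqc hw', inv_mul_cancel_left] at hq'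
      obtain ⟨w₁, w₂, rfl, h4⟩ := exists_enter w' (one_notMem_halfSpace x b) (by simpa using hq')
      rw [one_mul] at h4
      have h5 := (commute_letter (gen_commute_of_mem_link h4) b).eq
      have h6 : copyDist (g * letter Γ (x, b)) q ≤ (w₁ ++ w₂).length := by
        apply copyDist_le
        have : g * letter Γ (x, b) * wordProd Γ (w₁ ++ w₂) =
            g * wordProd Γ (w₁ ++ (x, b) :: w₂) := by
          simp only [wordProd_append, wordProd_cons]
          rw [mul_assoc, ← mul_assoc (letter Γ (x, b)), h5, mul_assoc]
        rw [this]
        exact hw'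
      rw [← hwl']
      refine h6.trans ?_
      simp

/-! ### Short cycles in the extension graph -/

theorem powersNotCommute_of_isVertex {a b : PCGroup Γ} (ha : IsVertex a) (hb : IsVertex b)
    (h : ¬ Commute a b) : PowersNotCommute a b := by
  intro p q hp hq hc
  rw [← zpow_natCast, ← zpow_natCast, ha.commute_zpow_iff (by exact_mod_cast hp.ne'),
    Commute.symm_iff, hb.commute_zpow_iff (by exact_mod_cast hq.ne')] at hc
  exact h hc.symm

/-- A vertex of the extension graph commuting with a generator but different from it belongs to
the subgroup of the link. -/
theorem mem_link_of_commute {x : V} {a : PCGroup Γ} (ha : IsVertex a) (hc : Commute (gen Γ x) a)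
    (hne : a ≠ gen Γ x) : a ∈ par Γ (Γ.neighborSet x) := by
  obtain ⟨g, ⟨x', e⟩, ⟨y, rfl⟩⟩ := exists_inCopy_of_commute (isVertex_gen x) ha hc
  have e' : (1 : PCGroup Γ) * gen Γ x * 1⁻¹ = g * gen Γ x' * g⁻¹ := by simpa using e
  obtain rfl := InCopy.eq_gen e'
  have hg : Commute (gen Γ x) g := by
    change gen Γ x * g = g * gen Γ x
    nth_rewrite 1 [e]; group
  have hxy : Commute (gen Γ x) (gen Γ y) := by
    rw [e, commute_conj_iff] at hc; exact hc
  rcases commute_gen_gen_iff.1 hxy with rfl | hadj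
  · exact absurd e.symm hne
  · have hy : y ∈ Γ.neighborSet x := hadj
    have := conj_mem_link (inv_mem (commute_gen_iff.1 hg)) (gen_mem_par hy)
    simpa using this

/-- The stars of two distinct vertices meet in an edge, a vertex, or not at all. -/
theorem commute_of_mem_star_inter_star (hsq : NoSquare Γ) {x y : V}
    (hxy : x ≠ y) {g h : PCGroup Γ} (hg : g ∈ par Γ (closedStar Γ x ∩ closedStar Γ y))
    (hh : h ∈ par Γ (closedStar Γ x ∩ closedStar Γ y)) : Commute g h := by
  have hgen : ∀ z ∈ closedStar Γ x ∩ closedStar Γ y, ∀ t ∈ closedStar Γ x ∩ closedStar Γ y,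
      Commute (gen Γ z) (gen Γ t) := by
    rintro z ⟨hzx, hzy⟩ t ⟨htx, hty⟩
    rcases hzx with rfl | hzx
    · exact commute_gen_gen_iff.2 htx
    rcases hzy with rfl | hzy
    · exact commute_gen_gen_iff.2 hty
    rcases htx with rfl | htx
    · exact (gen_commute hzx).symm
    rcases hty with rfl | hty
    · exact (gen_commute hzy).symm
    rw [hsq hxy hzx hzy htx hty]
  exact commute_of_mem_par (fun t ht =>
    (commute_of_mem_par (fun z hz => hgen t ht z hz) hg).symm) hh

/-- Two vertices of the extension graph which do not commute have at most one common neighbour. -/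
theorem eq_of_commute_of_commute (hsq : NoSquare Γ) {p q a b : PCGroup Γ}
    (hp : IsVertex p) (ha : IsVertex a) (hb : IsVertex b) (hpq : ¬ Commute p q)
    (hpa : Commute p a) (hqa : Commute q a) (hpb : Commute p b) (hqb : Commute q b) : a = b := by
  by_contra hab
  by_cases hcab : Commute a b
  · obtain ⟨g, ⟨x, rfl⟩, ⟨y, rfl⟩⟩ := exists_inCopy_of_commute ha hb hcab
    have hxy : x ≠ y := fun h => hab (by rw [h])
    have key : ∀ r, Commute r (g * gen Γ x * g⁻¹) → Commute r (g * gen Γ y * g⁻¹) →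
        g⁻¹ * r * g ∈ par Γ (closedStar Γ x ∩ closedStar Γ y) := by
      intro r h1 h2
      have e : r = g * (g⁻¹ * r * g) * g⁻¹ := by group
      rw [e, commute_conj_iff] at h1 h2
      exact mem_par_inter (commute_gen_iff.1 h1.symm) (commute_gen_iff.1 h2.symm)
    apply hpq
    rw [← commute_conj_iff g⁻¹, inv_inv]
    exact commute_of_mem_star_inter_star hsq hxy (key p hpa hpb) (key q hqa hqb)
  · obtain ⟨g, x, rfl⟩ := hp
    have e : ∀ r, Commute (g * gen Γ x * g⁻¹) r → Commute (gen Γ x) (g⁻¹ * r * g) := by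
      intro r hr
      have e : r = g * (g⁻¹ * r * g) * g⁻¹ := by group
      rwa [e, commute_conj_iff] at hr
    have hcomm : ∀ r s, Commute (g⁻¹ * r * g) (g⁻¹ * s * g) ↔ Commute r s := fun r s => by
      simpa using commute_conj_iff g⁻¹ r s
    have va : IsVertex (g⁻¹ * a * g) := by simpa using ha.conj g⁻¹
    have vb : IsVertex (g⁻¹ * b * g) := by simpa using hb.conj g⁻¹
    have hcab' : ¬ Commute (g⁻¹ * a * g) (g⁻¹ * b * g) := by rwa [hcomm]
    have h1 := mem_link_of_commute va (e a hpa) (fun h => hcab' (by rw [h]; exact e b hpb))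
    have h2 := mem_link_of_commute vb (e b hpb) (fun h => hcab' (by rw [h]; exact (e a hpa).symm))
    have h3 := mem_star_of_commute hsq h1 h2 (powersNotCommute_of_isVertex va vb hcab')
      ((hcomm q a).2 hqa) ((hcomm q b).2 hqb)
    apply hpq
    have h4 := gen_commute_of_mem_star h3
    have e5 : q = g * (g⁻¹ * q * g) * g⁻¹ := by group
    rw [e5, commute_conj_iff]
    exact h4

/-- A vertex of the extension graph adjacent to two vertices of a copy lies in this copy. -/
theorem inCopy_of_commute_of_commute (hsq : NoSquare Γ) {g a b w : PCGroup Γ}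
    (hw : IsVertex w) (ha : InCopy g a) (hb : InCopy g b) (hab : a ≠ b) (hwa : Commute w a)
    (hwb : Commute w b) : InCopy g w := by
  obtain ⟨x, rfl⟩ := ha
  obtain ⟨y, rfl⟩ := hb
  have hxy : x ≠ y := fun h => hab (by rw [h])
  have e : w = g * (g⁻¹ * w * g) * g⁻¹ := by group
  rw [e, commute_conj_iff, Commute.symm_iff, commute_gen_iff] at hwa hwb
  have hm := mem_par_inter hwa hwb
  obtain ⟨h, z, ez⟩ : IsVertex (g⁻¹ * w * g) := by simpa using hw.conj g⁻¹
  -- the retraction onto an abelian subgroup maps a conjugate of a generator to a generator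
  have hr := retr_eq_self hm
  have hrh := retr_mem (A := closedStar Γ x ∩ closedStar Γ y) h
  rw [ez, map_mul, map_mul, map_inv] at hr
  by_cases hz : z ∈ closedStar Γ x ∩ closedStar Γ y
  · rw [retr_gen_of_mem hz, (commute_of_mem_star_inter_star hsq hxy hrh (gen_mem_par hz)).eq,
      mul_inv_cancel_right, ← ez] at hr
    exact ⟨z, by rw [hr, ← e]⟩
  · rw [retr_gen_of_notMem hz, mul_one, mul_inv_cancel] at hr
    exact absurd hr.symm (IsVertex.ne_one ⟨h, z, rfl⟩)

end PCGroup

namespace PCGroup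

variable {V : Type*} {W : Type*} {Γ : SimpleGraph V} {Δ : SimpleGraph W}

/-! ### Atomic graphs -/

theorem noTriangle_of_isAtomicGraph (h : IsAtomicGraph Γ) : NoTriangle Γ := by
  intro x y z hxy hxz hyz
  have := h.five_le_length_of_isCycle x (.cons hxy (.cons hyz (.cons hxz.symm .nil))) (by
    rw [SimpleGraph.Walk.cons_isCycle_iff]
    simp [hxy.ne, hxy.ne', hxz.ne, hxz.ne', hyz.ne])
  simp at this

theorem noSquare_of_isAtomicGraph (h : IsAtomicGraph Γ) : NoSquare Γ := by
  intro x z a b hxz hxa hza hxb hzb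
  by_contra hab
  have := h.five_le_length_of_isCycle x
    (.cons hxa (.cons hza.symm (.cons hzb (.cons hxb.symm .nil)))) (by
    rw [SimpleGraph.Walk.cons_isCycle_iff]
    simp [hxa.ne, hxa.ne', hza.ne', hxb.ne, hxb.ne', hzb.ne, hab, hxz, hxz.symm])
  simp at this

theorem exists_two_neighbors [Nontrivial V] (h : IsAtomicGraph Γ) (v : V) :
    ∃ a b, a ≠ b ∧ Γ.Adj v a ∧ Γ.Adj v b := by
  obtain ⟨a, ha⟩ := h.connected.preconnected.exists_adj_of_nontrivial v
  have h1 := h.valence_ne_one v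
  by_contra hcon
  push Not at hcon
  apply h1
  rw [Set.ncard_eq_one]
  refine ⟨a, Set.eq_singleton_iff_unique_mem.2 ⟨ha, fun b hb => ?_⟩⟩
  by_contra hne
  exact hcon a b (Ne.symm hne) ha hb

variable (Γ) in
/-- Two vertices are joined by a path avoiding the set `S`. -/
def AvoidReach (S : Set V) : V → V → Prop :=
  Relation.ReflTransGen (fun a b => Γ.Adj a b ∧ a ∉ S ∧ b ∉ S)

theorem AvoidReach.symm {S : Set V} {p q : V} (h : AvoidReach Γ S p q) : AvoidReach Γ S q p := by
  have : Std.Symm (fun a b => Γ.Adj a b ∧ a ∉ S ∧ b ∉ S) :=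
    ⟨fun a b h => ⟨h.1.symm, h.2.2, h.2.1⟩⟩
  exact Relation.ReflTransGen.stdSymm.symm _ _ h

theorem AvoidReach.mono {S T : Set V} (hST : S ⊆ T) {p q : V} (h : AvoidReach Γ T p q) :
    AvoidReach Γ S p q :=
  Relation.ReflTransGen.mono
    (fun _ _ h => ⟨h.1, fun h1 => h.2.1 (hST h1), fun h1 => h.2.2 (hST h1)⟩) _ _ h

theorem avoidReach_of_preconnected {S : Set V} (h : (Γ.induce Sᶜ).Preconnected) {p q : V}
    (hp : p ∉ S) (hq : q ∉ S) : AvoidReach Γ S p q := by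
  have h1 := h ⟨p, hp⟩ ⟨q, hq⟩
  rw [SimpleGraph.reachable_iff_reflTransGen] at h1
  exact Relation.ReflTransGen.lift (p := fun a b => Γ.Adj a b ∧ a ∉ S ∧ b ∉ S)
    (fun a : ↥Sᶜ => a.1) (fun a b h => ⟨h, a.2, b.2⟩) _ _ h1

/-- A nontrivial atomic graph has no cut vertices. -/
theorem avoidReach_of_subsingleton [Nontrivial V] (h : IsAtomicGraph Γ) {S : Set V}
    (hS : S.Subsingleton) {p q : V} (hp : p ∉ S) (hq : q ∉ S) : AvoidReach Γ S p q := by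
  rcases hS.eq_empty_or_singleton with rfl | ⟨s, rfl⟩
  · have h1 := h.connected.preconnected p q
    rw [SimpleGraph.reachable_iff_reflTransGen] at h1
    exact Relation.ReflTransGen.mono (fun _ _ h => ⟨h, by simp, by simp⟩) _ _ h1
  · have key : ∀ p, p ≠ s → ∃ p', p' ∉ closedStar Γ s ∧ AvoidReach Γ {s} p p' := by
      intro p hp
      by_cases hps : p ∈ closedStar Γ s
      · have hsp : Γ.Adj s p := hps.resolve_left hp
        obtain ⟨c, hcs, hpc⟩ : ∃ c, c ≠ s ∧ Γ.Adj p c := by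
          obtain ⟨a, b, hab, ha, hb⟩ := exists_two_neighbors h p
          by_cases has : a = s
          · exact ⟨b, fun hbs => hab (has.trans hbs.symm), hb⟩
          · exact ⟨a, has, ha⟩
        refine ⟨c, ?_, .single ⟨hpc, hp, hcs⟩⟩
        rintro (hc | hc)
        · exact hcs hc
        · exact noTriangle_of_isAtomicGraph h hsp hc hpc
      · exact ⟨p, hps, .refl⟩
    obtain ⟨p', hp', h1⟩ := key p hp
    obtain ⟨q', hq', h2⟩ := key q hq
    have h3 := avoidReach_of_preconnected (h.not_separating_closedStar s) hp' hq'
    refine h1.trans (Relation.ReflTransGen.trans (AvoidReach.mono ?_ h3) h2.symm)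
    rintro _ rfl
    exact self_mem_star _

variable (Γ) in
/-- The union of the connected components of the complement of `S` which meet `Q`. -/
def comp (Q S : Set V) : Set V := {x | ∃ q ∈ Q, q ∉ S ∧ AvoidReach Γ S q x}

theorem notMem_of_avoidReach {S : Set V} {p q : V} (hp : p ∉ S) (h : AvoidReach Γ S p q) :
    q ∉ S := by
  rcases Relation.ReflTransGen.cases_tail h with rfl | ⟨_, _, h⟩
  · exact hp
  · exact h.2.2

theorem notMem_of_mem_comp {Q S : Set V} {x : V} (h : x ∈ comp Γ Q S) : x ∉ S := by
  obtain ⟨q, _, hq, hx⟩ := h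
  exact notMem_of_avoidReach hq hx

theorem mem_comp_of_adj {Q S : Set V} {x y : V} (h : x ∈ comp Γ Q S) (hxy : Γ.Adj x y)
    (hy : y ∉ S) : y ∈ comp Γ Q S := by
  have hx := notMem_of_mem_comp h
  obtain ⟨q, h1, h2, h3⟩ := h
  exact ⟨q, h1, h2, h3.tail ⟨hxy, hx, hy⟩⟩

/-- Replacing the separating set `S` by a set `T` such that the components beyond `T` avoid `S`
and `S ∩ T` has at most one element makes the union of components strictly smaller, since a graph
without cut vertices cannot be separated by `S ∩ T`. -/
theorem comp_ssubset_comp [Nontrivial V] (h : IsAtomicGraph Γ) {Q S T : Set V}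
    (hST : (S ∩ T).Subsingleton) (hdisj : ∀ x ∈ comp Γ Q T, x ∉ S) (hne : (comp Γ Q T).Nonempty)
    {x : V} (hx : x ∉ S) (hxc : x ∉ comp Γ Q S) : comp Γ Q T ⊂ comp Γ Q S := by
  have hsub : comp Γ Q T ⊆ comp Γ Q S := by
    rintro y ⟨q, hq, hqT, hy⟩
    have hqS : q ∉ S := hdisj q ⟨q, hq, hqT, .refl⟩
    refine ⟨q, hq, hqS, ?_⟩
    induction hy with
    | refl => exact .refl
    | @tail b c h1 h2 ih =>
      exact ih.tail ⟨h2.1, hdisj b ⟨q, hq, hqT, h1⟩, hdisj c ⟨q, hq, hqT, h1.tail h2⟩⟩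
  refine ⟨hsub, fun hsup => ?_⟩
  obtain ⟨a, ha⟩ := hne
  have h1 : AvoidReach Γ (S ∩ T) a x :=
    avoidReach_of_subsingleton h hST (fun h => hdisj a ha h.1) (fun h => hx h.1)
  have h2 : x ∈ comp Γ Q T := by
    clear hx hxc
    induction h1 with
    | refl => exact ha
    | @tail b c _ h2 ih =>
      by_cases hcS : c ∈ S
      · exact mem_comp_of_adj ih h2.1 (fun hcT => h2.2.2 ⟨hcS, hcT⟩)
      · exact hsup (mem_comp_of_adj (hsub ih) h2.1 hcS)
  exact hxc (hsub h2)

/-! ### The map of extension graphs induced by an embedding -/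

open Classical in
/-- The vertex of the extension graph of which `u` is a nontrivial power; the value is `1` if there
is none. -/
noncomputable def root (u : PCGroup Γ) : PCGroup Γ :=
  if h : ∃ w, IsVertex w ∧ ∃ n : ℤ, n ≠ 0 ∧ u = w ^ n then h.choose else 1

theorem root_eq {u w : PCGroup Γ} (hw : IsVertex w) {n : ℤ} (hn : n ≠ 0) (h : u = w ^ n) :
    root u = w := by
  have hex : ∃ w, IsVertex w ∧ ∃ n : ℤ, n ≠ 0 ∧ u = w ^ n := ⟨w, hw, n, hn, h⟩
  rw [root, dif_pos hex]
  obtain ⟨h1, m, hm, h2⟩ := hex.choose_spec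
  exact eq_of_zpow_eq_zpow h1 hw hm (h2.symm.trans h)

theorem root_of_isVertex {w : PCGroup Γ} (hw : IsVertex w) : root w = w :=
  root_eq hw one_ne_zero (zpow_one w).symm

/-- An embedding of a group given by a nontrivial atomic graph maps vertices of the extension graph
to powers of vertices, since their centralisers are not abelian. -/
theorem exists_eq_zpow [Nontrivial W] (hΔ : IsAtomicGraph Δ) (hΓ : IsAtomicGraph Γ)
    {φ : PCGroup Δ →* PCGroup Γ} (hφ : Function.Injective φ) {w : PCGroup Δ} (hw : IsVertex w) :
    ∃ w', IsVertex w' ∧ ∃ n : ℤ, n ≠ 0 ∧ φ w = w' ^ n := by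
  obtain ⟨g, v, rfl⟩ := hw
  obtain ⟨a, b, hab, ha, hb⟩ := exists_two_neighbors hΔ v
  have hne : φ (gen Δ v) ≠ 1 := fun h =>
    (isVertex_gen v).ne_one (hφ (h.trans (map_one φ).symm))
  have hcab : ¬ Commute (gen Δ a) (gen Δ b) := fun h => by
    rcases commute_gen_gen_iff.1 h with h | h
    · exact hab h.symm
    · exact noTriangle_of_isAtomicGraph hΔ ha hb h
  have hp : PowersNotCommute (φ (gen Δ a)) (φ (gen Δ b)) := by
    intro p q hp hq hc
    refine powersNotCommute_of_isVertex (isVertex_gen a) (isVertex_gen b) hcab p q hp hq ?_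
    apply hφ
    simpa using hc.eq
  obtain ⟨h, x, n, hn, e⟩ := exists_conj_eq_gen_zpow (noTriangle_of_isAtomicGraph hΓ)
    (noSquare_of_isAtomicGraph hΓ) hne ((gen_commute ha).map φ) ((gen_commute hb).map φ) hp
  refine ⟨φ g * h * gen Γ x * (φ g * h)⁻¹, ⟨_, _, rfl⟩, n, hn, ?_⟩
  rw [map_mul, map_mul, map_inv, e, conj_zpow]
  group

section RootMap

variable [Nontrivial W] (hΔ : IsAtomicGraph Δ) (hΓ : IsAtomicGraph Γ)
    {φ : PCGroup Δ →* PCGroup Γ} (hφ : Function.Injective φ)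
include hΔ hΓ hφ

theorem root_spec {w : PCGroup Δ} (hw : IsVertex w) :
    IsVertex (root (φ w)) ∧ ∃ n : ℤ, n ≠ 0 ∧ φ w = root (φ w) ^ n := by
  obtain ⟨w', h1, n, hn, h2⟩ := exists_eq_zpow hΔ hΓ hφ hw
  rw [root_eq h1 hn h2]
  exact ⟨h1, n, hn, h2⟩

theorem root_commute_iff {w w' : PCGroup Δ} (hw : IsVertex w) (hw' : IsVertex w') :
    Commute (root (φ w)) (root (φ w')) ↔ Commute w w' := by
  obtain ⟨h1, n, hn, e1⟩ := root_spec hΔ hΓ hφ hw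
  obtain ⟨h2, m, hm, e2⟩ := root_spec hΔ hΓ hφ hw'
  rw [← h1.commute_zpow_iff hn, ← e1, Commute.symm_iff, ← h2.commute_zpow_iff hm, ← e2,
    Commute.symm_iff]
  refine ⟨fun h => hφ ?_, fun h => h.map φ⟩
  simpa using h.eq

theorem root_injective {w w' : PCGroup Δ} (hw : IsVertex w) (hw' : IsVertex w')
    (h : root (φ w) = root (φ w')) : w = w' := by
  obtain ⟨h1, n, hn, e1⟩ := root_spec hΔ hΓ hφ hw
  obtain ⟨h2, m, hm, e2⟩ := root_spec hΔ hΓ hφ hw'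
  refine eq_of_zpow_eq_zpow hw hw' hm (m := n) (hφ ?_)
  rw [map_zpow, map_zpow, e1, e2, h, ← zpow_mul, ← zpow_mul, mul_comm]

theorem root_conj {w : PCGroup Δ} (hw : IsVertex w) (g : PCGroup Δ) :
    root (φ (g * w * g⁻¹)) = φ g * root (φ w) * (φ g)⁻¹ := by
  obtain ⟨h1, n, hn, e1⟩ := root_spec hΔ hΓ hφ hw
  refine root_eq (h1.conj _) hn ?_
  rw [conj_zpow, ← e1, map_mul, map_mul, map_inv]

end RootMap

theorem root_comp {U : Type*} {Λ : SimpleGraph U} [Nontrivial W] [Nontrivial V]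
    (hΔ : IsAtomicGraph Δ) (hΓ : IsAtomicGraph Γ) (hΛ : IsAtomicGraph Λ)
    {φ : PCGroup Δ →* PCGroup Γ} (hφ : Function.Injective φ)
    {ψ : PCGroup Γ →* PCGroup Λ} (hψ : Function.Injective ψ) {w : PCGroup Δ} (hw : IsVertex w) :
    root (ψ.comp φ w) = root (ψ (root (φ w))) := by
  obtain ⟨h1, n, hn, e1⟩ := root_spec hΔ hΓ hφ hw
  obtain ⟨h2, m, hm, e2⟩ := root_spec hΓ hΛ hψ h1
  refine root_eq h2 (mul_ne_zero hm hn) ?_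
  rw [zpow_mul, ← e2, ← map_zpow, ← e1]; rfl

/-! ### Rigid sets of vertices -/

/-- The vertices of `Δ` whose images in the extension graph of `Γ` lie in the star of `v`. -/
def starPreimage (φ : PCGroup Δ →* PCGroup Γ) (v : PCGroup Γ) : Set W :=
  {x | Commute v (root (φ (gen Δ x)))}

section Sides

variable [Nontrivial W] (hΔ : IsAtomicGraph Δ) (hΓ : IsAtomicGraph Γ)
    {φ : PCGroup Δ →* PCGroup Γ} (hφ : Function.Injective φ)
include hΔ hΓ hφ

theorem starPreimage_root (x : W) :
    starPreimage φ (root (φ (gen Δ x))) = closedStar Δ x := by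
  ext y
  change Commute _ _ ↔ _
  rw [root_commute_iff hΔ hΓ hφ (isVertex_gen x) (isVertex_gen y), commute_gen_gen_iff]
  rfl

theorem onFarSide_congr_of_avoidReach {k : PCGroup Γ} {y : V} {b : Bool} {p q : W}
    (h : AvoidReach Δ (starPreimage φ (k * gen Γ y * k⁻¹)) p q) :
    OnFarSide k y b (root (φ (gen Δ p))) ↔ OnFarSide k y b (root (φ (gen Δ q))) := by
  induction h with
  | refl => rfl
  | @tail c d _ h ih =>
    rw [ih]
    refine onFarSide_congr_of_commute h.2.1 h.2.2 (root_spec hΔ hΓ hφ (isVertex_gen _)).1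
      (root_spec hΔ hΓ hφ (isVertex_gen _)).1 ?_
    rw [root_commute_iff hΔ hΓ hφ (isVertex_gen _) (isVertex_gen _)]
    exact gen_commute h.1

/-- If the images of the vertices in `Q` lie in one copy, but in no copy containing `p`, then some
star separates `p` from all of `Q` outside this star. -/
theorem exists_separating {Q : Finset W} (hQ : ∃ g, ∀ x ∈ Q, InCopy g (root (φ (gen Δ x))))
    {p : PCGroup Γ} (hp : IsVertex p)
    (hpQ : ¬ ∃ g, (∀ x ∈ Q, InCopy g (root (φ (gen Δ x)))) ∧ InCopy g p) :
    ∃ k y b, ¬ Commute (k * gen Γ y * k⁻¹) p ∧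
      (comp Δ Q (starPreimage φ (k * gen Γ y * k⁻¹))).Nonempty ∧
      ∀ x ∈ comp Δ Q (starPreimage φ (k * gen Γ y * k⁻¹)),
        ¬ (OnFarSide k y b (root (φ (gen Δ x))) ↔ OnFarSide k y b p) := by
  classical
  obtain ⟨g, hg⟩ := hQ
  by_contra hcon
  push Not at hcon
  apply hpQ
  have hv : ∀ x, IsVertex (root (φ (gen Δ x))) :=
    fun x => (root_spec hΔ hΓ hφ (isVertex_gen x)).1
  obtain ⟨g', hg'⟩ := exists_inCopy_of_not_separated
    (insert p (Q.image fun x => root (φ (gen Δ x)))) (by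
      intro r hr
      rcases Finset.mem_insert.1 hr with rfl | hr
      · exact hp
      · obtain ⟨x, _, rfl⟩ := Finset.mem_image.1 hr
        exact hv x) (by
      have key : ∀ k y b, ∀ x ∈ Q, ¬ Commute (k * gen Γ y * k⁻¹) p →
          ¬ Commute (k * gen Γ y * k⁻¹) (root (φ (gen Δ x))) →
          (OnFarSide k y b (root (φ (gen Δ x))) ↔ OnFarSide k y b p) := by
        intro k y b x hx h1 h2
        obtain ⟨z, ⟨q, hq, hqS, hz⟩, h3⟩ := hcon k y b h1 ⟨x, x, hx, h2, .refl⟩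
        rw [← h3, ← onFarSide_congr_of_avoidReach hΔ hΓ hφ hz]
        exact onFarSide_congr h2 hqS (hg x hx) (hg q hq)
      intro k y b r hr s hs hrc hsc
      rcases Finset.mem_insert.1 hr with rfl | hr
      · rcases Finset.mem_insert.1 hs with rfl | hs
        · exact id
        · obtain ⟨x, hx, rfl⟩ := Finset.mem_image.1 hs
          exact (key k y b x hx hrc hsc).2
      · obtain ⟨x, hx, rfl⟩ := Finset.mem_image.1 hr
        rcases Finset.mem_insert.1 hs with rfl | hs
        · exact (key k y b x hx hsc hrc).1
        · obtain ⟨z, hz, rfl⟩ := Finset.mem_image.1 hs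
          exact (onFarSide_congr hrc hsc (hg x hx) (hg z hz)).1)
  exact ⟨g', fun x hx => hg' _ (Finset.mem_insert_of_mem (Finset.mem_image_of_mem _ hx)),
    hg' _ (Finset.mem_insert_self _ _)⟩

end Sides

variable (Γ) in
/-- A set of vertices is rigid if every injective endomorphism of the group maps it into a single
copy of `Γ` in the extension graph. -/
def Rigid (Q : Finset V) : Prop :=
  ∀ φ : PCGroup Γ →* PCGroup Γ, Function.Injective φ →
    ∃ g, ∀ x ∈ Q, InCopy g (root (φ (gen Γ x)))

variable (Γ) in
/-- A pair of an injective endomorphism and a vertex of the extension graph whose star separates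
the image of some element of `Q` from the image of some vertex. -/
structure IsCut (Q : Finset V) (c : (PCGroup Γ →* PCGroup Γ) × PCGroup Γ) : Prop where
  injective : Function.Injective c.1
  isVertex : IsVertex c.2
  nonempty : (comp Γ Q (starPreimage c.1 c.2)).Nonempty
  separates : ∃ x, x ∉ starPreimage c.1 c.2 ∧ x ∉ comp Γ Q (starPreimage c.1 c.2)

variable [Nontrivial V]

theorem IsCut.ne_root (hΓ : IsAtomicGraph Γ) {Q : Finset V}
    {c : (PCGroup Γ →* PCGroup Γ) × PCGroup Γ} (hc : IsCut Γ Q c) (x : V) :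
    c.2 ≠ root (c.1 (gen Γ x)) := by
  intro h
  obtain ⟨_, q, hq, hqS, _⟩ := hc.nonempty
  obtain ⟨z, hz, hzc⟩ := hc.separates
  refine hzc ⟨q, hq, hqS, avoidReach_of_preconnected ?_ hqS hz⟩
  rw [h, starPreimage_root hΓ hΓ hc.injective]
  exact hΓ.not_separating_closedStar x

theorem IsCut.nontrivial (hΓ : IsAtomicGraph Γ) {Q : Finset V}
    {c : (PCGroup Γ →* PCGroup Γ) × PCGroup Γ} (hc : IsCut Γ Q c) :
    (starPreimage c.1 c.2).Nontrivial := by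
  rw [← Set.not_subsingleton_iff]
  intro h
  obtain ⟨_, q, hq, hqS, _⟩ := hc.nonempty
  obtain ⟨z, hz, hzc⟩ := hc.separates
  exact hzc ⟨q, hq, hqS, avoidReach_of_subsingleton hΓ h hqS hz⟩

theorem mem_starPreimage_comp_iff (hΓ : IsAtomicGraph Γ) {φ ψ : PCGroup Γ →* PCGroup Γ}
    (hφ : Function.Injective φ) (hψ : Function.Injective ψ) {v : PCGroup Γ} (hv : IsVertex v)
    (x : V) : x ∈ starPreimage φ v ↔ Commute (root (ψ v)) (root (ψ.comp φ (gen Γ x))) := by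
  rw [root_comp hΓ hΓ hΓ hφ hψ (isVertex_gen x), root_commute_iff hΓ hΓ hψ hv
    (root_spec hΓ hΓ hφ (isVertex_gen x)).1]
  rfl

/-- For a rigid set `Q` and a cut with the smallest possible part on the side of `Q`, the cutting
vertex stays in a common copy with `Q` under all further endomorphisms: a star separating them
would yield a cut with a smaller part. -/
theorem IsCut.exists_inCopy [Finite V] (hΓ : IsAtomicGraph Γ) {Q : Finset V} (hQ : Rigid Γ Q)
    {c : (PCGroup Γ →* PCGroup Γ) × PCGroup Γ} (hc : IsCut Γ Q c)
    (hmin : ∀ c', IsCut Γ Q c' → (comp Γ Q (starPreimage c.1 c.2)).ncard ≤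
      (comp Γ Q (starPreimage c'.1 c'.2)).ncard)
    {ψ : PCGroup Γ →* PCGroup Γ} (hψ : Function.Injective ψ) :
    ∃ g, (∀ x ∈ Q, InCopy g (root (ψ.comp c.1 (gen Γ x)))) ∧ InCopy g (root (ψ c.2)) := by
  by_contra hcon
  obtain ⟨φ, v⟩ := c
  have hφ : Function.Injective φ := hc.injective
  have hv : IsVertex v := hc.isVertex
  have hψφ : Function.Injective (ψ.comp φ) := hψ.comp hφ
  have vψ : IsVertex (root (ψ v)) := (root_spec hΓ hΓ hψ hv).1
  obtain ⟨k, y, b, h1, h2, h3⟩ := exists_separating hΓ hΓ hψφ (hQ _ hψφ) vψ hcon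
  set w := k * gen Γ y * k⁻¹ with hw
  have vw : IsVertex w := ⟨k, y, rfl⟩
  have hS := mem_starPreimage_comp_iff hΓ hφ hψ hv
  have hroot : ∀ x, IsVertex (root (ψ.comp φ (gen Γ x))) :=
    fun x => (root_spec hΓ hΓ hψφ (isVertex_gen x)).1
  have hST : (starPreimage φ v ∩ starPreimage (ψ.comp φ) w).Subsingleton := by
    intro x hx z hz
    apply gen_injective (Γ := Γ)
    refine root_injective hΓ hΓ hψφ (isVertex_gen x) (isVertex_gen z) ?_
    exact eq_of_commute_of_commute (noSquare_of_isAtomicGraph hΓ) vw (hroot x) (hroot z) h1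
      hx.2 ((hS x).1 hx.1) hz.2 ((hS z).1 hz.1)
  have hdisj : ∀ x ∈ comp Γ Q (starPreimage (ψ.comp φ) w), x ∉ starPreimage φ v := by
    intro x hx hxS
    have hxT : x ∉ starPreimage (ψ.comp φ) w := notMem_of_mem_comp hx
    refine h3 x hx (onFarSide_congr_of_commute hxT h1 (hroot x) vψ ?_)
    exact ((hS x).1 hxS).symm
  obtain ⟨z, hz, hzc⟩ := hc.separates
  have hlt := Set.ncard_lt_ncard (comp_ssubset_comp hΓ hST hdisj h2 hz hzc) (Set.toFinite _)
  refine absurd (hmin (ψ.comp φ, w) ⟨hψφ, vw, h2, ?_⟩) (not_le.2 hlt)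
  obtain ⟨s, hs, t, ht, hst⟩ := hc.nontrivial hΓ
  by_cases hsT : s ∈ starPreimage (ψ.comp φ) w
  · exact ⟨t, fun htT => hst (hST ⟨hs, hsT⟩ ⟨ht, htT⟩), fun h => hdisj t h ht⟩
  · exact ⟨s, hsT, fun h => hdisj s h hs⟩

/-- Every injective endomorphism of the group of a nontrivial atomic graph maps the graph onto a
copy of itself in the extension graph, that is, the set of all vertices is rigid. A rigid set of
maximal cardinality which is not everything could be enlarged by the cutting vertex of a minimal
cut. -/
theorem rigid_univ [Finite V] (hΓ : IsAtomicGraph Γ) {φ : PCGroup Γ →* PCGroup Γ}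
    (hφ : Function.Injective φ) : ∃ g, ∀ x, InCopy g (root (φ (gen Γ x))) := by
  classical
  obtain ⟨Q, hQ, hmax⟩ := Set.exists_max_image {Q : Finset V | Rigid Γ Q} Finset.card
    (Set.toFinite _) ⟨∅, fun _ _ => ⟨1, by simp⟩⟩
  have hQ : Rigid Γ Q := hQ
  by_cases hall : ∀ x, x ∈ Q
  · obtain ⟨g, hg⟩ := hQ φ hφ
    exact ⟨g, fun x => hg x (hall x)⟩
  exfalso
  push Not at hall
  obtain ⟨x, hx⟩ := hall
  have hnr : ¬ Rigid Γ (insert x Q) := by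
    intro h
    have := hmax _ h
    rw [Finset.card_insert_of_notMem hx] at this
    omega
  have hcut : ∃ c, IsCut Γ Q c := by
    unfold Rigid at hnr
    push Not at hnr
    obtain ⟨θ, hθ, h⟩ := hnr
    obtain ⟨k, y, b, h1, h2, h3⟩ := exists_separating hΓ hΓ hθ (hQ θ hθ)
      (root_spec hΓ hΓ hθ (isVertex_gen x)).1 (by
        rintro ⟨g, hg1, hg2⟩
        obtain ⟨z, hz, hz2⟩ := h g
        rcases Finset.mem_insert.1 hz with rfl | hz
        · exact hz2 hg2
        · exact hz2 (hg1 z hz))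
    exact ⟨(θ, k * gen Γ y * k⁻¹), hθ, ⟨k, y, rfl⟩, h2, x, h1, fun h => h3 x h Iff.rfl⟩
  obtain ⟨c, hc, hmin⟩ := (measure fun c : (PCGroup Γ →* PCGroup Γ) × PCGroup Γ =>
    (comp Γ Q (starPreimage c.1 c.2)).ncard).wf.has_min {c | IsCut Γ Q c} hcut
  have hc : IsCut Γ Q c := hc
  have hmin : ∀ c', IsCut Γ Q c' → (comp Γ Q (starPreimage c.1 c.2)).ncard ≤
      (comp Γ Q (starPreimage c'.1 c'.2)).ncard := fun c' h => not_lt.1 (hmin c' h)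
  obtain ⟨g, hg1, hg2⟩ := hc.exists_inCopy hΓ hQ hmin (ψ := MonoidHom.id _) Function.injective_id
  rw [MonoidHom.id_apply, root_of_isVertex hc.isVertex] at hg2
  have hτ : ∀ z, ∃ t, z ∈ Q → root (c.1 (gen Γ z)) = g * gen Γ t * g⁻¹ := by
    intro z
    by_cases hz : z ∈ Q
    · obtain ⟨t, ht⟩ := hg1 z hz
      exact ⟨t, fun _ => ht⟩
    · exact ⟨z, fun h => absurd h hz⟩
  choose τ hτ using hτ
  obtain ⟨s, hs⟩ := hg2
  have hinj : Set.InjOn τ Q := by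
    intro z hz t ht hzt
    apply gen_injective (Γ := Γ)
    refine root_injective hΓ hΓ hc.injective (isVertex_gen z) (isVertex_gen t) ?_
    rw [hτ z hz, hτ t ht, hzt]
  have hsn : s ∉ Q.image τ := by
    intro h
    obtain ⟨z, hz, rfl⟩ := Finset.mem_image.1 h
    exact hc.ne_root hΓ z (by rw [hs, hτ z hz])
  have hnew : Rigid Γ (insert s (Q.image τ)) := by
    intro ψ hψ
    obtain ⟨g', h1, h2⟩ := hc.exists_inCopy hΓ hQ hmin hψ
    have hback : ∀ t u, IsVertex u → u = g * gen Γ t * g⁻¹ → InCopy g' (root (ψ u)) →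
        InCopy ((ψ g)⁻¹ * g') (root (ψ (gen Γ t))) := by
      intro t u hu e hi
      have e2 : gen Γ t = g⁻¹ * u * g⁻¹⁻¹ := by rw [e]; group
      rw [e2, root_conj hΓ hΓ hψ hu, map_inv]
      exact hi.conj _
    refine ⟨(ψ g)⁻¹ * g', fun t ht => ?_⟩
    rcases Finset.mem_insert.1 ht with rfl | ht
    · exact hback _ _ hc.isVertex hs h2
    · obtain ⟨z, hz, rfl⟩ := Finset.mem_image.1 ht
      refine hback _ _ (root_spec hΓ hΓ hc.injective (isVertex_gen z)).1 (hτ z hz) ?_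
      rw [← root_comp hΓ hΓ hΓ hc.injective hψ (isVertex_gen z)]
      exact h1 z hz
  have := hmax _ hnew
  rw [Finset.card_insert_of_notMem hsn, Finset.card_image_of_injOn hinj] at this
  omega

/-! ### Mutual embeddings -/

/-- If the groups of two nontrivial atomic graphs embed into each other, then the first graph is an
induced subgraph of the second. A star separating the image of `Γ` in the extension graph of `Δ`
would be mapped to a star separating a full copy of `Γ` in the extension graph of `Γ`. -/
theorem nonempty_embedding [Finite V] [Nontrivial W] (hΓ : IsAtomicGraph Γ) (hΔ : IsAtomicGraph Δ)
    {ψ : PCGroup Γ →* PCGroup Δ} (hψ : Function.Injective ψ)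
    {φ : PCGroup Δ →* PCGroup Γ} (hφ : Function.Injective φ) : Nonempty (Γ ↪g Δ) := by
  classical
  have hroot : ∀ x, IsVertex (root (ψ (gen Γ x))) :=
    fun x => (root_spec hΓ hΔ hψ (isVertex_gen x)).1
  obtain ⟨g, hg⟩ : ∃ g, ∀ x, InCopy g (root (ψ (gen Γ x))) := by
    have := Fintype.ofFinite V
    by_contra hcon
    have h1 : ¬ ∃ g, ∀ p ∈ Finset.univ.image fun x => root (ψ (gen Γ x)), InCopy g p :=
      fun ⟨g, h⟩ => hcon ⟨g, fun x => h _ (Finset.mem_image_of_mem _ (Finset.mem_univ x))⟩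
    have h2 := mt (exists_inCopy_of_not_separated _ (by simpa using hroot)) h1
    push Not at h2
    obtain ⟨k, y, b, p, hp, q, hq, hpc, hqc, hpf, hqf⟩ := h2
    obtain ⟨p, _, rfl⟩ := Finset.mem_image.1 hp
    obtain ⟨q, _, rfl⟩ := Finset.mem_image.1 hq
    set v := k * gen Δ y * k⁻¹ with hv
    have vv : IsVertex v := ⟨k, y, rfl⟩
    have hnr : ¬ AvoidReach Γ (starPreimage ψ v) p q := fun h =>
      hqf ((onFarSide_congr_of_avoidReach hΓ hΔ hψ h).1 hpf)
    have hnt : (starPreimage ψ v).Nontrivial := by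
      rw [← Set.not_subsingleton_iff]
      exact fun h => hnr (avoidReach_of_subsingleton hΓ h hpc hqc)
    -- after mapping back to the extension graph of `Γ`, the image of `Γ` is a full copy, and the
    -- separating vertex is adjacent to two of its vertices
    have hφψ : Function.Injective (φ.comp ψ) := hφ.comp hψ
    obtain ⟨h, hh⟩ := rigid_univ hΓ hφψ
    have hmem : ∀ x, x ∈ starPreimage ψ v ↔
        Commute (root (φ v)) (root (φ.comp ψ (gen Γ x))) := by
      intro x
      rw [root_comp hΓ hΔ hΓ hψ hφ (isVertex_gen x), root_commute_iff hΔ hΓ hφ vv (hroot x)]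
      rfl
    obtain ⟨s, hs, t, ht, hst⟩ := hnt
    have hin : InCopy h (root (φ v)) := by
      refine inCopy_of_commute_of_commute (noSquare_of_isAtomicGraph hΓ)
        (root_spec hΔ hΓ hφ vv).1 (hh s) (hh t) (fun e => hst ?_) ((hmem s).1 hs) ((hmem t).1 ht)
      exact gen_injective (root_injective hΓ hΓ hφψ (isVertex_gen s) (isVertex_gen t) e)
    choose σ hσ using hh
    have hσi : Function.Injective σ := by
      intro x z hxz
      apply gen_injective (Γ := Γ)
      refine root_injective hΓ hΓ hφψ (isVertex_gen x) (isVertex_gen z) ?_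
      rw [hσ x, hσ z, hxz]
    obtain ⟨z, hz⟩ := hin
    obtain ⟨x, rfl⟩ := Finite.surjective_of_injective hσi z
    rw [← hσ x] at hz
    have hstar : starPreimage ψ v = closedStar Γ x := by
      rw [← starPreimage_root hΓ hΓ hφψ x]
      ext r
      rw [hmem, hz]; rfl
    refine hnr (avoidReach_of_preconnected ?_ hpc hqc)
    rw [hstar]
    exact hΓ.not_separating_closedStar x
  choose σ hσ using hg
  have hinj : Function.Injective σ := by
    intro x z hxz
    apply gen_injective (Γ := Γ)
    refine root_injective hΓ hΔ hψ (isVertex_gen x) (isVertex_gen z) ?_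
    rw [hσ x, hσ z, hxz]
  refine ⟨⟨⟨σ, hinj⟩, ?_⟩⟩
  intro x z
  have h1 := root_commute_iff hΓ hΔ hψ (isVertex_gen x) (isVertex_gen z)
  rw [hσ x, hσ z, commute_conj_iff, commute_gen_gen_iff, commute_gen_gen_iff] at h1
  change Δ.Adj (σ x) (σ z) ↔ Γ.Adj x z
  constructor
  · intro h
    refine (h1.1 (Or.inr h)).resolve_left ?_
    rintro rfl
    exact h.ne rfl
  · intro h
    refine (h1.2 (Or.inr h)).resolve_left (fun e => h.ne (hinj e).symm)

end PCGroup

namespace PCGroup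

variable {V : Type*} {W : Type*} {Γ : SimpleGraph V} {Δ : SimpleGraph W}

/-! ### Isomorphic graphs and graphs with one vertex -/

theorem exists_injective_of_iso (e : Δ ≃g Γ) :
    ∃ f : PCGroup Δ →* PCGroup Γ, Function.Injective f := by
  let f : PCGroup Δ →* PCGroup Γ :=
    lift (fun x => gen Γ (e x)) (fun _ _ h => gen_commute (e.map_adj_iff.2 h))
  let f' : PCGroup Γ →* PCGroup Δ :=
    lift (fun x => gen Δ (e.symm x)) (fun _ _ h => gen_commute (e.symm.map_adj_iff.2 h))
  have h : f'.comp f = MonoidHom.id _ := by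
    refine PresentedGroup.ext fun x => ?_
    change f' (f (gen Δ x)) = gen Δ x
    simp [f, f']
  refine ⟨f, Function.LeftInverse.injective (g := f') fun g => ?_⟩
  exact DFunLike.congr_fun h g

/-- The group of a nontrivial atomic graph is not abelian, whereas the group of a graph with one
vertex is cyclic. -/
theorem subsingleton_of_injective [Subsingleton V] (hΔ : IsAtomicGraph Δ)
    {f : PCGroup Δ →* PCGroup Γ} (hf : Function.Injective f) : Subsingleton W := by
  by_contra h
  rw [not_subsingleton_iff_nontrivial] at h
  have v : W := hΔ.connected.nonempty.some
  obtain ⟨a, b, hab, ha, hb⟩ := exists_two_neighbors hΔ v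
  have hc : Commute (gen Δ a) (gen Δ b) := by
    have h1 : Commute (f (gen Δ a)) (f (gen Δ b)) :=
      commute_of_mem_par_subsingleton (Set.subsingleton_of_subsingleton (s := Set.univ))
        (mem_par_univ _) (mem_par_univ _)
    apply hf
    simpa using h1.eq
  rcases commute_gen_gen_iff.1 hc with h | h
  · exact hab h.symm
  · exact noTriangle_of_isAtomicGraph hΔ ha hb h

end PCGroup

theorem mainTheorem2 {V : Type*} {W : Type*} [Finite V] [Finite W]
    (Δ : SimpleGraph V) (Γ : SimpleGraph W) (hΔ : IsAtomicGraph Δ) (hΓ : IsAtomicGraph Γ) :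
    ((∃ f : PCGroup Δ →* PCGroup Γ, Function.Injective f) ∧
      (∃ g : PCGroup Γ →* PCGroup Δ, Function.Injective g)) ↔ Nonempty (Δ ≃g Γ) := by
  constructor
  · rintro ⟨⟨f, hf⟩, ⟨g, hg⟩⟩
    have hV := hΔ.connected.nonempty
    have hW := hΓ.connected.nonempty
    rcases subsingleton_or_nontrivial V with hVs | hVn
    · have hWs : Subsingleton W := PCGroup.subsingleton_of_injective hΓ hg
      obtain ⟨uV⟩ := (unique_iff_subsingleton_and_nonempty V).2 ⟨hVs, hV⟩
      obtain ⟨uW⟩ := (unique_iff_subsingleton_and_nonempty W).2 ⟨hWs, hW⟩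
      exact ⟨⟨Equiv.ofUnique V W, fun {a b} => by
        rw [Subsingleton.elim a b]; simp⟩⟩
    rcases subsingleton_or_nontrivial W with hWs | hWn
    · have := PCGroup.subsingleton_of_injective hΔ hf
      exact absurd this (not_subsingleton V)
    obtain ⟨i⟩ := PCGroup.nonempty_embedding hΔ hΓ hf hg
    obtain ⟨j⟩ := PCGroup.nonempty_embedding hΓ hΔ hg hf
    have hbij : Function.Bijective i :=
      i.injective.bijective_of_nat_card_le (Nat.card_le_card_of_injective j j.injective)
    exact ⟨RelIso.ofSurjective i hbij.2⟩
  · rintro ⟨e⟩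
    exact ⟨PCGroup.exists_injective_of_iso e, PCGroup.exists_injective_of_iso e.symm⟩
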